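/- Setting. Let $\mathcal C$ be a concrete monoidal $W^*$-category: a category whose morphism spaces are complex Banach spaces with bilinear composition, $\|fg\|\le\|f\|\|g\|$ and isometric conjugate-linear involutions $f\mapsto f^*$ satisfying $(fg)^*=g^*f^*$ and $\|f^*f\|=\|f\|^2$, each morphism space being the dual of a Banach space; with a monoidal structure $(\otimes,\mathbb 1)$ whose tensor product of morphisms is bilinear, $^*$-preserving and separately ultraweakly continuous; and with a normal (ultraweakly continuous), linear, $^*$-preserving strong monoidal functor, with unitary structure isomorphisms, to Hilbert spaces with the completed tensor product. The Hilbert space underlying $H\in\mathcal C$ is denoted $\mathcal H$ (similarly $K,\mathcal K$ and $L,\mathcal L$), morphisms are identified with the underlying bounded operators, and the functor and coherence isomorphisms are suppressed. $[S]$ is the norm-closed linear span of a set $S$ of operators, $\mathbb K$ denotes compact operators, and $\mathbb B(\cdot)_*$ denotes the normal functionals. Let $c$ be a unitary braiding on $\mathcal C$ which is bi-regular: for all $H,K\in\mathcal C$, $$[(\mathrm{id}\otimes\omega)(c_{H,K})\mid\omega\in\mathbb B(\mathcal K,\mathcal H)_*]=\mathbb K(\mathcal H,\mathcal K),\qquad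 [(\omega\otimes\mathrm{id})(c_{H,K})\mid\omega\in\mathbb B(\mathcal H,\mathcal K)_*]=\mathbb K(\mathcal K,\mathcal H).$$ Let $L\in\mathcal C$, write $c=c_{L,L}$, and let $F\in\mathrm{End}_{\mathcal C}(L\otimes L)$ be a bi-regular multiplicative unitary, i.e. $F$ is unitary, satisfies the pentagon equation $$F_{23}F_{12}=F_{12}\,(c^{-1})_{12}\,F_{23}\,c_{12}\,F_{23},$$ and $$[(\mathrm{id}\otimes\omega)(c^{-1}F)\mid\omega\in\mathbb B(\mathcal L)_*]=\mathbb K(\mathcal L)=[(\omega\otimes\mathrm{id})(cF^*)\mid\omega\in\mathbb B(\mathcal L)_*].$$ For $X\in\mathrm{End}_{\mathcal C}(L\otimes L)$ put $A(X)=[(\omega\otimes\mathrm{id})(X)\mid\omega\in\mathbb B(\mathcal L)_*]\subseteq\mathbb B(\mathcal L)$, and let $\hat F=cF^*c^{-1}$ (the dual of $F$ formed in $(\mathcal C,\otimes^{\mathrm{op}},c^{-1})$). For $a,b\in\mathbb B(\mathcal L)$ put $a\boxtimes\mathrm{id}=a\otimes\mathrm{id}_{\mathcal L}$ and $\mathrm{id}\boxtimes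 b=c^{-1}(b\otimes\mathrm{id}_{\mathcal L})c$, and for subspaces $A,B\subseteq\mathbb B(\mathcal L)$ put $A\boxtimes B=[(A\boxtimes\mathrm{id})(\mathrm{id}\boxtimes B)]\subseteq\mathbb B(\mathcal L\otimes\mathcal L)$. Theorem. Under these assumptions: 1. $F$ is a multiplier of $A(\hat F)\boxtimes A(F)$; that is, $A(\hat F)\boxtimes A(F)$ is a $C^*$-subalgebra of $\mathbb B(\mathcal L\otimes\mathcal L)$ acting non-degenerately, and $Fx$ and $xF$ belong to it for every $x$ in it. 2. $[(A(\hat F)\boxtimes\mathrm{id})\,F\,(\mathrm{id}\boxtimes A(F))]=A(\hat F)\boxtimes A(F)$. -/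

import Mathlib

open CategoryTheory MonoidalCategory
open scoped TensorProduct InnerProductSpace ComplexConjugate

universe u v w

noncomputable section

/-! ## Hilbert spaces: completed tensor product, normal functionals, slices -/

/-- The (completed) tensor product of Hilbert spaces. -/
abbrev HilbertTensor (E F : Type*) [NormedAddCommGroup E] [InnerProductSpace ℂ E]
    [NormedAddCommGroup F] [InnerProductSpace ℂ F] : Type _ :=
  UniformSpace.Completion (E ⊗[ℂ] F)

namespace HilbertTensor

variable {E F G K : Type*}
  [NormedAddCommGroup E] [InnerProductSpace ℂ E]
  [NormedAddCommGroup F] [InnerProductSpace ℂ F]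
  [NormedAddCommGroup G] [InnerProductSpace ℂ G]
  [NormedAddCommGroup K] [InnerProductSpace ℂ K]

variable (E F) in
/-- The continuous bilinear map `(x, y) ↦ x ⊗ y` into the Hilbert space tensor product. -/
def tmul : E →L[ℂ] F →L[ℂ] HilbertTensor E F :=
  (ContinuousLinearMap.compL ℂ F (E ⊗[ℂ] F) (HilbertTensor E F)
    UniformSpace.Completion.toComplL).comp (TensorProduct.mkL ℂ E F)

theorem tmul_apply (x : E) (y : F) :
    tmul E F x y = ((x ⊗ₜ[ℂ] y : E ⊗[ℂ] F) : HilbertTensor E F) := rfl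

theorem inner_tmul_tmul (x x' : E) (y y' : F) :
    ⟪tmul E F x y, tmul E F x' y'⟫_ℂ = ⟪x, x'⟫_ℂ * ⟪y, y'⟫_ℂ := by
  rw [tmul_apply, tmul_apply, UniformSpace.Completion.inner_coe, TensorProduct.inner_tmul]

variable (G) in
/-- The operator `a ⊗ id_G` on Hilbert space tensor products, for a bounded operator `a`. -/
def ampl (a : E →L[ℂ] F) : HilbertTensor E G →L[ℂ] HilbertTensor F G :=
  ((UniformSpace.Completion.toComplL : F ⊗[ℂ] G →L[ℂ] HilbertTensor F G).comp
    (a.rTensor G)).extend (UniformSpace.Completion.toComplL : E ⊗[ℂ] G →L[ℂ] HilbertTensor E G)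

theorem ampl_tmul (a : E →L[ℂ] F) (x : E) (y : G) :
    ampl G a (tmul E G x y) = tmul F G (a x) y :=
  ContinuousLinearMap.extend_eq
    (e := (UniformSpace.Completion.toComplL : E ⊗[ℂ] G →L[ℂ] HilbertTensor E G)) _
    UniformSpace.Completion.denseRange_coe
    (UniformSpace.Completion.isUniformInducing_coe _) (x ⊗ₜ[ℂ] y)

end HilbertTensor

section Operators

variable {E F G K : Type*}
  [NormedAddCommGroup E] [InnerProductSpace ℂ E]
  [NormedAddCommGroup F] [InnerProductSpace ℂ F]
  [NormedAddCommGroup G] [InnerProductSpace ℂ G] [CompleteSpace G]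
  [NormedAddCommGroup K] [InnerProductSpace ℂ K] [CompleteSpace K]

/-- The closed linear span `[S]` of a set of operators. -/
def closedSpan (S : Set (E →L[ℂ] F)) : Submodule ℂ (E →L[ℂ] F) :=
  (Submodule.span ℂ S).topologicalClosure

/-- The vector functional `T ↦ ⟪ξ, T η⟫` on `B(E, F)`. -/
def vectorFunctional (ξ : F) (η : E) : StrongDual ℂ (E →L[ℂ] F) :=
  (innerSL ℂ ξ).comp (ContinuousLinearMap.apply ℂ F η)

variable (E F) in
/-- The predual `B(E, F)_*`, realised as the space of normal functionals on `B(E, F)`: the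
norm closure of the linear span of the vector functionals. -/
def normalFunctionals : Submodule ℂ (StrongDual ℂ (E →L[ℂ] F)) :=
  (Submodule.span ℂ
    (Set.range fun p : F × E => vectorFunctional p.1 p.2)).topologicalClosure

/-- Auxiliary to `sliceOf`: the functional `x ↦ conj (ω ((S x)† T (R y)))` on `G`, where `R`, `S`
are bounded families of operators indexed by `E`, `G`. -/
def sliceFunctional {P Q : Type*}
    [NormedAddCommGroup P] [InnerProductSpace ℂ P]
    [NormedAddCommGroup Q] [InnerProductSpace ℂ Q] [CompleteSpace Q]
    (R : E →L[ℂ] F →L[ℂ] P) (S : G →L[ℂ] K →L[ℂ] Q) (T : P →L[ℂ] Q)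
    (ω : StrongDual ℂ (F →L[ℂ] K)) (y : E) : StrongDual ℂ G :=
  LinearMap.mkContinuous
    { toFun := fun x => conj (ω ((ContinuousLinearMap.adjoint (S x)).comp (T.comp (R y))))
      map_add' := fun x x' => by
        simp only [map_add, ContinuousLinearMap.add_comp]
      map_smul' := fun c x => by
        simp only [map_smul, map_smulₛₗ, ContinuousLinearMap.smul_comp, smul_eq_mul, map_mul,
          RingHom.id_apply, RCLike.conj_conj] }
    (‖ω‖ * ‖S‖ * (‖T‖ * ‖R y‖)) fun x => by
      have h1 : ‖(ContinuousLinearMap.adjoint (S x)).comp (T.comp (R y))‖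
          ≤ (‖S‖ * ‖x‖) * (‖T‖ * ‖R y‖) := by
        refine (ContinuousLinearMap.opNorm_comp_le _ _).trans ?_
        rw [LinearIsometryEquiv.norm_map]
        gcongr
        · exact S.le_opNorm x
        · exact ContinuousLinearMap.opNorm_comp_le _ _
      calc ‖conj (ω ((ContinuousLinearMap.adjoint (S x)).comp (T.comp (R y))))‖
          = ‖ω ((ContinuousLinearMap.adjoint (S x)).comp (T.comp (R y)))‖ := RCLike.norm_conj _
        _ ≤ ‖ω‖ * ((‖S‖ * ‖x‖) * (‖T‖ * ‖R y‖)) :=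
            (ω.le_opNorm _).trans (mul_le_mul_of_nonneg_left h1 (norm_nonneg _))
        _ = ‖ω‖ * ‖S‖ * (‖T‖ * ‖R y‖) * ‖x‖ := by ring

/-- The bounded operator `Z : E → G` determined by `⟪x, Z y⟫ = ω ((S x)† T (R y))`. -/
def sliceOf {P Q : Type*}
    [NormedAddCommGroup P] [InnerProductSpace ℂ P]
    [NormedAddCommGroup Q] [InnerProductSpace ℂ Q] [CompleteSpace Q]
    (R : E →L[ℂ] F →L[ℂ] P) (S : G →L[ℂ] K →L[ℂ] Q) (T : P →L[ℂ] Q)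
    (ω : StrongDual ℂ (F →L[ℂ] K)) : E →L[ℂ] G :=
  LinearMap.mkContinuous
    { toFun := fun y => (InnerProductSpace.toDual ℂ G).symm (sliceFunctional R S T ω y)
      map_add' := fun y y' => by
        rw [← map_add]
        congr 1
        ext x
        simp [sliceFunctional]
      map_smul' := fun c y => by
        rw [RingHom.id_apply]
        apply (InnerProductSpace.toDual ℂ G).injective
        rw [map_smulₛₗ, LinearIsometryEquiv.apply_symm_apply,
          LinearIsometryEquiv.apply_symm_apply]
        ext x
        simp [sliceFunctional] }
    (‖ω‖ * ‖S‖ * ‖T‖ * ‖R‖) fun y => by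
      change ‖(InnerProductSpace.toDual ℂ G).symm (sliceFunctional R S T ω y)‖ ≤ _
      rw [LinearIsometryEquiv.norm_map]
      refine (LinearMap.mkContinuous_norm_le _ (by positivity) _).trans ?_
      calc ‖ω‖ * ‖S‖ * (‖T‖ * ‖R y‖) ≤ ‖ω‖ * ‖S‖ * (‖T‖ * (‖R‖ * ‖y‖)) := by
            gcongr
            exact R.le_opNorm y
        _ = ‖ω‖ * ‖S‖ * ‖T‖ * ‖R‖ * ‖y‖ := by ring

theorem inner_sliceOf {P Q : Type*}
    [NormedAddCommGroup P] [InnerProductSpace ℂ P]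
    [NormedAddCommGroup Q] [InnerProductSpace ℂ Q] [CompleteSpace Q]
    (R : E →L[ℂ] F →L[ℂ] P) (S : G →L[ℂ] K →L[ℂ] Q) (T : P →L[ℂ] Q)
    (ω : StrongDual ℂ (F →L[ℂ] K)) (x : G) (y : E) :
    ⟪x, sliceOf R S T ω y⟫_ℂ =
      ω ((ContinuousLinearMap.adjoint (S x)).comp (T.comp (R y))) := by
  rw [← inner_conj_symm]
  change conj ⟪(InnerProductSpace.toDual ℂ G).symm (sliceFunctional R S T ω y), x⟫_ℂ = _
  rw [InnerProductSpace.toDual_symm_apply]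
  exact RCLike.conj_conj _

/-- The slice `(id ⊗ ω)(T) ∈ B(E, G)` of `T ∈ B(E ⊗ F, G ⊗ K)` over the right leg. -/
def sliceRight (ω : StrongDual ℂ (F →L[ℂ] K)) (T : HilbertTensor E F →L[ℂ] HilbertTensor G K) :
    E →L[ℂ] G :=
  sliceOf (HilbertTensor.tmul E F) (HilbertTensor.tmul G K) T ω

/-- The slice `(ω ⊗ id)(T) ∈ B(F, K)` of `T ∈ B(E ⊗ F, G ⊗ K)` over the left leg. -/
def sliceLeft (ω : StrongDual ℂ (E →L[ℂ] G)) (T : HilbertTensor E F →L[ℂ] HilbertTensor G K) :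
    F →L[ℂ] K :=
  sliceOf (HilbertTensor.tmul E F).flip (HilbertTensor.tmul G K).flip T ω

/-- `[(id ⊗ ω)(T) | ω ∈ B(F, K)_*]`. -/
def rightSlices (T : HilbertTensor E F →L[ℂ] HilbertTensor G K) : Submodule ℂ (E →L[ℂ] G) :=
  closedSpan {a | ∃ ω ∈ normalFunctionals F K, a = sliceRight ω T}

/-- `[(ω ⊗ id)(T) | ω ∈ B(E, G)_*]`. -/
def leftSlices (T : HilbertTensor E F →L[ℂ] HilbertTensor G K) : Submodule ℂ (F →L[ℂ] K) :=
  closedSpan {b | ∃ ω ∈ normalFunctionals E G, b = sliceLeft ω T}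

variable (E F) in
/-- The compact operators `K(E, F)`. -/
def compacts : Submodule ℂ (E →L[ℂ] F) := compactOperator (RingHom.id ℂ) E F

/-- A linear subspace of `B(E)` is a `C*`-subalgebra if it is norm closed and closed under
products and adjoints. -/
structure IsCStarSubalgebra [CompleteSpace E] (A : Submodule ℂ (E →L[ℂ] E)) : Prop where
  isClosed : IsClosed (A : Set (E →L[ℂ] E))
  mul_mem : ∀ a ∈ A, ∀ b ∈ A, a * b ∈ A
  star_mem : ∀ a ∈ A, star a ∈ A

/-- `A ⊆ B(E)` acts non-degenerately: the vectors `a x` with `a ∈ A`, `x ∈ E` span a dense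
subspace of `E`. -/
def ActsNondegenerately (A : Submodule ℂ (E →L[ℂ] E)) : Prop :=
  (Submodule.span ℂ {z : E | ∃ a ∈ A, ∃ x : E, z = a x}).topologicalClosure = ⊤

/-- `T` belongs to the multiplier algebra of `A ⊆ B(E)`: here `A` is a `C*`-algebra acting
non-degenerately on `E`, and its multiplier algebra is its idealiser in `B(E)`. -/
structure IsMultiplierOf [CompleteSpace E] (A : Submodule ℂ (E →L[ℂ] E)) (T : E →L[ℂ] E) :
    Prop where
  isCStarSubalgebra : IsCStarSubalgebra A
  nondegenerate : ActsNondegenerately A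
  mul_mem_left : ∀ a ∈ A, T * a ∈ A
  mul_mem_right : ∀ a ∈ A, a * T ∈ A

end Operators

/-! ## Monoidal `W*`-categories -/

/-- A `C*`-category. -/
class CStarCategory (C : Type u) [Category.{v} C] where
  homNormedAddCommGroup (X Y : C) : NormedAddCommGroup (X ⟶ Y)
  homNormedSpace (X Y : C) : NormedSpace ℂ (X ⟶ Y)
  homComplete (X Y : C) : CompleteSpace (X ⟶ Y)
  add_comp {X Y Z : C} (f g : X ⟶ Y) (h : Y ⟶ Z) : (f + g) ≫ h = f ≫ h + g ≫ h
  comp_add {X Y Z : C} (f : X ⟶ Y) (g h : Y ⟶ Z) : f ≫ (g + h) = f ≫ g + f ≫ h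
  smul_comp {X Y Z : C} (c : ℂ) (f : X ⟶ Y) (g : Y ⟶ Z) : (c • f) ≫ g = c • (f ≫ g)
  comp_smul {X Y Z : C} (c : ℂ) (f : X ⟶ Y) (g : Y ⟶ Z) : f ≫ (c • g) = c • (f ≫ g)
  norm_comp_le {X Y Z : C} (f : X ⟶ Y) (g : Y ⟶ Z) : ‖f ≫ g‖ ≤ ‖g‖ * ‖f‖
  /-- The involution `f ↦ f*`. -/
  adj {X Y : C} (f : X ⟶ Y) : Y ⟶ X
  adj_adj {X Y : C} (f : X ⟶ Y) : adj (adj f) = f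
  adj_add {X Y : C} (f g : X ⟶ Y) : adj (f + g) = adj f + adj g
  adj_smul {X Y : C} (c : ℂ) (f : X ⟶ Y) : adj (c • f) = conj c • adj f
  adj_comp {X Y Z : C} (f : X ⟶ Y) (g : Y ⟶ Z) : adj (f ≫ g) = adj g ≫ adj f
  norm_adj {X Y : C} (f : X ⟶ Y) : ‖adj f‖ = ‖f‖
  norm_comp_adj {X Y : C} (f : X ⟶ Y) : ‖f ≫ adj f‖ = ‖f‖ ^ 2

attribute [reducible, instance] CStarCategory.homNormedAddCommGroup CStarCategory.homNormedSpace
attribute [instance] CStarCategory.homComplete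

/-- A `W*`-category: a `C*`-category all of whose morphism spaces are dual Banach spaces. -/
class WStarCategory (C : Type u) [Category.{v} C] extends CStarCategory C where
  /-- The predual of `X ⟶ Y`. -/
  predual : C → C → Type v
  predualNormedAddCommGroup (X Y : C) : NormedAddCommGroup (predual X Y)
  predualNormedSpace (X Y : C) : NormedSpace ℂ (predual X Y)
  predualComplete (X Y : C) : CompleteSpace (predual X Y)
  /-- The identification of `X ⟶ Y` with the dual of its predual. -/
  toDual (X Y : C) : (X ⟶ Y) ≃ₗᵢ[ℂ] StrongDual ℂ (predual X Y)

attribute [reducible, instance] WStarCategory.predualNormedAddCommGroup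
  WStarCategory.predualNormedSpace
attribute [instance] WStarCategory.predualComplete

/-- The ultraweakly continuous linear functionals on `X ⟶ Y`, that is, those given by evaluation
at an element of the predual. -/
def IsNormalFunctional {C : Type u} [Category.{v} C] [WStarCategory C] {X Y : C}
    (φ : (X ⟶ Y) → ℂ) : Prop :=
  ∃ p : WStarCategory.predual X Y, ∀ f : X ⟶ Y, φ f = WStarCategory.toDual X Y f p

/-- Ultraweak continuity of a linear map between morphism spaces: it pulls ultraweakly continuous
functionals back to ultraweakly continuous functionals. -/
def IsNormalMap {C : Type u} [Category.{v} C] [WStarCategory C] {X Y X' Y' : C}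
    (Φ : (X ⟶ Y) → (X' ⟶ Y')) : Prop :=
  ∀ φ : (X' ⟶ Y') → ℂ, IsNormalFunctional φ → IsNormalFunctional (φ ∘ Φ)

/-- A monoidal `W*`-category: the tensor product is a normal bifunctor of `W*`-categories. -/
class MonoidalWStarCategory (C : Type u) [Category.{v} C] [MonoidalCategory C]
    [WStarCategory C] : Prop where
  add_tensor {X Y X' Y' : C} (f g : X ⟶ Y) (h : X' ⟶ Y') : (f + g) ⊗ₘ h = f ⊗ₘ h + g ⊗ₘ h
  tensor_add {X Y X' Y' : C} (f : X ⟶ Y) (g h : X' ⟶ Y') : f ⊗ₘ (g + h) = f ⊗ₘ g + f ⊗ₘ h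
  smul_tensor {X Y X' Y' : C} (c : ℂ) (f : X ⟶ Y) (g : X' ⟶ Y') :
    (c • f) ⊗ₘ g = c • (f ⊗ₘ g)
  tensor_smul {X Y X' Y' : C} (c : ℂ) (f : X ⟶ Y) (g : X' ⟶ Y') :
    f ⊗ₘ (c • g) = c • (f ⊗ₘ g)
  adj_tensor {X Y X' Y' : C} (f : X ⟶ Y) (g : X' ⟶ Y') :
    CStarCategory.adj (f ⊗ₘ g) = CStarCategory.adj f ⊗ₘ CStarCategory.adj g
  normal_tensor_left {X Y X' Y' : C} (g : X' ⟶ Y') :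
    IsNormalMap fun f : X ⟶ Y => f ⊗ₘ g
  normal_tensor_right {X Y X' Y' : C} (f : X ⟶ Y) :
    IsNormalMap fun g : X' ⟶ Y' => f ⊗ₘ g

/-- A morphism in a `C*`-category is unitary. -/
def IsUnitaryMorphism {C : Type u} [Category.{v} C] [CStarCategory C] {X Y : C}
    (f : X ⟶ Y) : Prop :=
  f ≫ CStarCategory.adj f = 𝟙 X ∧ CStarCategory.adj f ≫ f = 𝟙 Y

/-- A normal strong monoidal functor from a monoidal `W*`-category to Hilbert spaces. Together
with such a functor, `C` is a concrete monoidal `W*`-category. The structure isomorphisms `μ`, `ε`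
are unitary. Their compatibility with the associators and unitors is expressed on elementary
tensors, whose span is dense. -/
structure FibreFunctor (C : Type u) [Category.{v} C] [MonoidalCategory C] [WStarCategory C] where
  /-- The underlying Hilbert space of an object. -/
  obj : C → Type w
  objNormedAddCommGroup (X : C) : NormedAddCommGroup (obj X)
  objInnerProductSpace (X : C) : InnerProductSpace ℂ (obj X)
  objComplete (X : C) : CompleteSpace (obj X)
  /-- The underlying bounded operator of a morphism. -/
  map {X Y : C} (f : X ⟶ Y) : obj X →L[ℂ] obj Y
  map_id (X : C) : map (𝟙 X) = ContinuousLinearMap.id ℂ (obj X)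
  map_comp {X Y Z : C} (f : X ⟶ Y) (g : Y ⟶ Z) : map (f ≫ g) = (map g).comp (map f)
  map_add {X Y : C} (f g : X ⟶ Y) : map (f + g) = map f + map g
  map_smul {X Y : C} (c : ℂ) (f : X ⟶ Y) : map (c • f) = c • map f
  map_adj {X Y : C} (f : X ⟶ Y) :
    map (CStarCategory.adj f) = ContinuousLinearMap.adjoint (map f)
  normal {X Y : C} (ω : StrongDual ℂ (obj X →L[ℂ] obj Y)) :
    ω ∈ normalFunctionals (obj X) (obj Y) → IsNormalFunctional fun f : X ⟶ Y => ω (map f)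
  /-- The coherence isomorphism `For(X) ⊗ For(Y) → For(X ⊗ Y)`. -/
  μ (X Y : C) : HilbertTensor (obj X) (obj Y) ≃ₗᵢ[ℂ] obj (X ⊗ Y)
  /-- The coherence isomorphism `ℂ → For(𝟙)`. -/
  ε : ℂ ≃ₗᵢ[ℂ] obj (𝟙_ C)
  μ_natural {X Y X' Y' : C} (f : X ⟶ Y) (g : X' ⟶ Y') (x : obj X) (x' : obj X') :
    map (f ⊗ₘ g) (μ X X' (HilbertTensor.tmul (obj X) (obj X') x x')) =
      μ Y Y' (HilbertTensor.tmul (obj Y) (obj Y') (map f x) (map g x'))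
  μ_associator (X Y Z : C) (x : obj X) (y : obj Y) (z : obj Z) :
    map (α_ X Y Z).hom
        (μ (X ⊗ Y) Z (HilbertTensor.tmul (obj (X ⊗ Y)) (obj Z)
          (μ X Y (HilbertTensor.tmul (obj X) (obj Y) x y)) z)) =
      μ X (Y ⊗ Z) (HilbertTensor.tmul (obj X) (obj (Y ⊗ Z)) x
        (μ Y Z (HilbertTensor.tmul (obj Y) (obj Z) y z)))
  μ_leftUnitor (X : C) (c : ℂ) (x : obj X) :
    map (λ_ X).hom (μ (𝟙_ C) X (HilbertTensor.tmul (obj (𝟙_ C)) (obj X) (ε c) x)) = c • x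
  μ_rightUnitor (X : C) (x : obj X) (c : ℂ) :
    map (ρ_ X).hom (μ X (𝟙_ C) (HilbertTensor.tmul (obj X) (obj (𝟙_ C)) x (ε c))) = c • x

attribute [instance] FibreFunctor.objNormedAddCommGroup FibreFunctor.objInnerProductSpace
  FibreFunctor.objComplete

namespace FibreFunctor

variable {C : Type u} [Category.{v} C] [MonoidalCategory C] [WStarCategory C]

/-- The operator `For(X) ⊗ For(Y) → For(X') ⊗ For(Y')` underlying a morphism
`X ⊗ Y ⟶ X' ⊗ Y'`. -/
def op (Φ : FibreFunctor.{u, v, w} C) {X Y X' Y' : C} (f : X ⊗ Y ⟶ X' ⊗ Y') :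
    HilbertTensor (Φ.obj X) (Φ.obj Y) →L[ℂ] HilbertTensor (Φ.obj X') (Φ.obj Y') :=
  ((Φ.μ X' Y').symm.toContinuousLinearEquiv : Φ.obj (X' ⊗ Y') →L[ℂ] _).comp
    ((Φ.map f).comp
      ((Φ.μ X Y).toContinuousLinearEquiv : _ →L[ℂ] Φ.obj (X ⊗ Y)))

end FibreFunctor

/-! ## Braidings, multiplicative unitaries, bi-regularity -/

section Braided

variable {C : Type u} [Category.{v} C] [MonoidalCategory C] [BraidedCategory C] [WStarCategory C]

variable (C) in
/-- The braiding is unitary. -/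
def IsUnitaryBraiding : Prop := ∀ X Y : C, IsUnitaryMorphism (β_ X Y).hom

/-- The braiding `c` is bi-regular: it is unitary, regular on `(C, ⊗)`, that is
`[(id ⊗ ω)(c_{X,Y})] = K(X, Y)`, and regular on `(C, ⊗^op)`, that is
`[(ω ⊗ id)(c_{X,Y})] = K(Y, X)`, for all objects `X`, `Y`. -/
structure IsBiregularBraiding (Φ : FibreFunctor.{u, v, w} C) : Prop where
  unitary : IsUnitaryBraiding C
  regular : ∀ X Y : C, rightSlices (Φ.op (β_ X Y).hom) = compacts (Φ.obj X) (Φ.obj Y)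
  regular_op : ∀ X Y : C, leftSlices (Φ.op (β_ X Y).hom) = compacts (Φ.obj Y) (Φ.obj X)

/-- `f₁₂ = f ⊗ id` on `(L ⊗ L) ⊗ L`. -/
def leg₁₂ {L : C} (f : L ⊗ L ⟶ L ⊗ L) : (L ⊗ L) ⊗ L ⟶ (L ⊗ L) ⊗ L := f ▷ L

/-- `f₂₃ = id ⊗ f`, transported to `(L ⊗ L) ⊗ L`. -/
def leg₂₃ {L : C} (f : L ⊗ L ⟶ L ⊗ L) : (L ⊗ L) ⊗ L ⟶ (L ⊗ L) ⊗ L :=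
  (α_ L L L).hom ≫ L ◁ f ≫ (α_ L L L).inv

/-- A multiplicative unitary: a unitary `F` with
`F₂₃ F₁₂ = F₁₂ (c⁻¹)₁₂ F₂₃ c₁₂ F₂₃` (composition is written from left to right below). -/
structure IsMultiplicativeUnitary {L : C} (F : L ⊗ L ⟶ L ⊗ L) : Prop where
  unitary : IsUnitaryMorphism F
  pentagon : leg₁₂ F ≫ leg₂₃ F =
    leg₂₃ F ≫ leg₁₂ (β_ L L).hom ≫ leg₂₃ F ≫ leg₁₂ (β_ L L).inv ≫ leg₁₂ F

/-- `F` is bi-regular: `F` is regular in `(C, ⊗, c)`, that is `[(id ⊗ ω)(c⁻¹ F)] = K(L)`, and `F*`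
is regular in `(C, ⊗^op, c⁻¹)`, that is `[(ω ⊗ id)(c F*)] = K(L)`. -/
structure IsBiregular (Φ : FibreFunctor.{u, v, w} C) {L : C} (F : L ⊗ L ⟶ L ⊗ L) : Prop where
  regular : rightSlices (Φ.op (F ≫ (β_ L L).inv)) = compacts (Φ.obj L) (Φ.obj L)
  regular_op : leftSlices (Φ.op (CStarCategory.adj F ≫ (β_ L L).hom)) =
    compacts (Φ.obj L) (Φ.obj L)

/-- `A(F) = [(ω ⊗ id)(F) | ω ∈ B(L)_*]`. -/
def leftSliceAlgebra (Φ : FibreFunctor.{u, v, w} C) {L : C} (F : L ⊗ L ⟶ L ⊗ L) :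
    Submodule ℂ (Φ.obj L →L[ℂ] Φ.obj L) :=
  leftSlices (Φ.op F)

/-- The dual `c F* c⁻¹` of `F`, formed in `(C, ⊗^op, c⁻¹)`. -/
def dualUnitary {L : C} (F : L ⊗ L ⟶ L ⊗ L) : L ⊗ L ⟶ L ⊗ L :=
  (β_ L L).inv ≫ CStarCategory.adj F ≫ (β_ L L).hom

/-- The inclusion `a ↦ a ⊠ id = a ⊗ id` of the first factor of the braided tensor product. -/
def inclLeft (Φ : FibreFunctor.{u, v, w} C) (X Y : C) (a : Φ.obj X →L[ℂ] Φ.obj X) :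
    HilbertTensor (Φ.obj X) (Φ.obj Y) →L[ℂ] HilbertTensor (Φ.obj X) (Φ.obj Y) :=
  HilbertTensor.ampl (Φ.obj Y) a

/-- The inclusion `b ↦ id ⊠ b = c⁻¹ (b ⊗ id) c` of the second factor of the braided tensor
product. -/
def inclRight (Φ : FibreFunctor.{u, v, w} C) (X Y : C) (b : Φ.obj Y →L[ℂ] Φ.obj Y) :
    HilbertTensor (Φ.obj X) (Φ.obj Y) →L[ℂ] HilbertTensor (Φ.obj X) (Φ.obj Y) :=
  (Φ.op (β_ X Y).inv).comp
    ((HilbertTensor.ampl (Φ.obj X) b).comp (Φ.op (β_ X Y).hom))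

/-- The braided tensor product `A ⊠ B = [(A ⊗ id) · c⁻¹ (B ⊗ id) c] ⊆ B(X ⊗ Y)`. -/
def braidedTensor (Φ : FibreFunctor.{u, v, w} C) {X Y : C}
    (A : Submodule ℂ (Φ.obj X →L[ℂ] Φ.obj X)) (B : Submodule ℂ (Φ.obj Y →L[ℂ] Φ.obj Y)) :
    Submodule ℂ (HilbertTensor (Φ.obj X) (Φ.obj Y) →L[ℂ] HilbertTensor (Φ.obj X) (Φ.obj Y)) :=
  closedSpan {T | ∃ a ∈ A, ∃ b ∈ B, T = inclLeft Φ X Y a * inclRight Φ X Y b}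

end Braided

end

/-!
# The multiplicative unitary as a multiplier of `A(F̂) ⊠ A(F)`

All spaces of operators are handled as closed linear spans, with the associative product
`S ⋆ T = [S T]` (`cmul`). Write `J` for the space of creation operators `T_x : y ↦ x ⊗ y`. The
space of left slices of `X` is then `A(X) = J* ⋆ X ⋆ J` (`leftSlices_eq`), the compact operators on
the first leg are `J ⋆ J*`, and `J* ⋆ J` is the line spanned by the identity. Three rules drive
every computation on `(H ⊗ H) ⊗ H`: operators `X₂₃` pass through creation operators on the first
leg; unitaries `U₁₂` disappear next to creation operators on the first two legs; and
if the left slices of `X` span the compact operators then slicing `X₁₂` over the first leg gives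
`J ⋆ J*` (`adjS_cmul_uline_cmul_of_regular`).

Slicing the pentagon equation over two legs gives `[A A] = A` and, by regularity, `A* = [A* A]` for
`A = A(F)`, so that `A` is a `C*`-algebra. With a braiding `d` whose left slices are the compact
operators, naturality gives `[J* d⁻¹(A ⊗ id)d] = [A J*]` (`adjS_creations_cmul_twisted`): next to
operators of rank one on the first leg, conjugation by the braiding is invisible. It follows
that `F` is a multiplier of `K ⊗ A(F)` (`uline_cmul_creations_cmul_slices`). The dual
`F̂ = c F* c⁻¹` satisfies the pentagon equation for the inverse braiding (`dual_pentagon`), and the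
regularity condition it needs is the one assumed for `F`; thus all this applies to `F̂` as well.

Put `W = c₁₂ F₂₃ c₁₂⁻¹ = c₂₃⁻¹ F₁₂ c₂₃`, whose slices over the first leg span `id ⊠ A(F)`. Since
`F₂₃` commutes with `A(F̂) ⊗ id ⊗ id`, the spaces `A(F̂) ⊠ id` and `id ⊠ A(F)` commute
(`leftFactor_cmul_rightFactor`), so their product `D = A(F̂) ⊠ A(F)` is a `C*`-algebra.
The pentagon equation reads `F₂₃ W F̂₁₂ = F̂₁₂ W` (`mul_conj`). Slicing it over the first leg, and
using that `F̂` and `W` are multipliers of `K ⊗ A(F̂)` and of `K` times `id ⊠ A(F)`, gives `[F D] = D`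
(`uline_cmul_braidedProduct`) and `[(A(F̂) ⊠ id) F (id ⊠ A(F))] = D`
(`leftFactor_cmul_uline_cmul_rightFactor`).
-/

noncomputable section

open ContinuousLinearMap (adjoint)

/-! ### Completed tensor products of Hilbert spaces -/

namespace HilbertTensor

variable {E F G : Type*}
  [NormedAddCommGroup E] [InnerProductSpace ℂ E]
  [NormedAddCommGroup F] [InnerProductSpace ℂ F]
  [NormedAddCommGroup G] [InnerProductSpace ℂ G]

theorem ext_tmul {M : Type*} [NormedAddCommGroup M] [NormedSpace ℂ M]
    {S T : HilbertTensor E F →L[ℂ] M} (h : ∀ x y, S (tmul E F x y) = T (tmul E F x y)) :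
    S = T := by
  have : (S : HilbertTensor E F → M) = T := by
    refine UniformSpace.Completion.ext S.continuous T.continuous fun t => ?_
    induction t using TensorProduct.induction_on with
    | zero => rw [UniformSpace.Completion.coe_zero, map_zero, map_zero]
    | tmul x y => exact h x y
    | add a b ha hb => rw [UniformSpace.Completion.coe_add, map_add, map_add, ha, hb]
  exact DFunLike.coe_injective this

variable (E F) in
theorem closure_span_tmul :
    (Submodule.span ℂ {z : HilbertTensor E F | ∃ x y, z = tmul E F x y}).topologicalClosure
      = ⊤ := by
  rw [eq_top_iff]
  intro z _
  refine UniformSpace.Completion.induction_on z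
    (Submodule.isClosed_topologicalClosure _) fun t => Submodule.le_topologicalClosure _ ?_
  induction t using TensorProduct.induction_on with
  | zero => rw [UniformSpace.Completion.coe_zero]; exact Submodule.zero_mem _
  | tmul x y => exact Submodule.subset_span ⟨x, y, rfl⟩
  | add a b ha hb => rw [UniformSpace.Completion.coe_add]; exact Submodule.add_mem _ ha hb

variable (G) in
theorem norm_ampl_le (a : E →L[ℂ] F) : ‖ampl G a‖ ≤ ‖a‖ := by
  refine ContinuousLinearMap.opNorm_le_bound _ (norm_nonneg _) fun z => ?_
  refine UniformSpace.Completion.induction_on z ?_ fun t => ?_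
  · exact isClosed_le (by fun_prop) (by fun_prop)
  · have : ampl G a (t : HilbertTensor E G) = ((a.rTensor G t : F ⊗[ℂ] G) : HilbertTensor F G) :=
      ContinuousLinearMap.extend_eq
        (e := (UniformSpace.Completion.toComplL : E ⊗[ℂ] G →L[ℂ] HilbertTensor E G)) _
        UniformSpace.Completion.denseRange_coe
        (UniformSpace.Completion.isUniformInducing_coe _) t
    rw [this, UniformSpace.Completion.norm_coe, UniformSpace.Completion.norm_coe]
    exact ((a.rTensor G).le_opNorm t).trans
      (mul_le_mul_of_nonneg_right (ContinuousLinearMap.norm_rTensor_le _ a) (norm_nonneg _))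

end HilbertTensor

/-- The Hilbert space tensor product as a type of its own. Its topology and its vector space
structure are reached through its norm only, and not also through the completion, so that
operators between iterated tensor products live in syntactically equal types. -/
def HTensor (E F : Type*) [NormedAddCommGroup E] [InnerProductSpace ℂ E]
    [NormedAddCommGroup F] [InnerProductSpace ℂ F] : Type _ :=
  HilbertTensor E F

namespace HTensor

variable {E F G K : Type*}
  [NormedAddCommGroup E] [InnerProductSpace ℂ E]
  [NormedAddCommGroup F] [InnerProductSpace ℂ F]
  [NormedAddCommGroup G] [InnerProductSpace ℂ G]
  [NormedAddCommGroup K] [InnerProductSpace ℂ K]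

instance : NormedAddCommGroup (HTensor E F) :=
  inferInstanceAs (NormedAddCommGroup (HilbertTensor E F))

instance : InnerProductSpace ℂ (HTensor E F) :=
  inferInstanceAs (InnerProductSpace ℂ (HilbertTensor E F))

instance : CompleteSpace (HTensor E F) :=
  inferInstanceAs (CompleteSpace (HilbertTensor E F))

variable (E F) in
/-- The continuous bilinear map `(x, y) ↦ x ⊗ y`. The operator `tmul E F x` is the creation
operator `T_x : y ↦ x ⊗ y`. -/
def tmul : E →L[ℂ] F →L[ℂ] HTensor E F := HilbertTensor.tmul E F

variable (G) in
/-- The operator `a ⊗ id_G`. -/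
def ampl (a : E →L[ℂ] F) : HTensor E G →L[ℂ] HTensor F G := HilbertTensor.ampl G a

/-- An operator on completed algebraic tensor products, regarded as one between spaces of type
`HTensor`. -/
def ofHilbertTensor (X : HilbertTensor E F →L[ℂ] HilbertTensor G K) :
    HTensor E F →L[ℂ] HTensor G K := X

theorem ampl_tmul (a : E →L[ℂ] F) (x : E) (y : G) :
    ampl G a (tmul E G x y) = tmul F G (a x) y :=
  HilbertTensor.ampl_tmul a x y

theorem inner_tmul_tmul (x x' : E) (y y' : F) :
    ⟪tmul E F x y, tmul E F x' y'⟫_ℂ = ⟪x, x'⟫_ℂ * ⟪y, y'⟫_ℂ :=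
  HilbertTensor.inner_tmul_tmul x x' y y'

theorem ext_tmul {M : Type*} [NormedAddCommGroup M] [NormedSpace ℂ M]
    {S T : HTensor E F →L[ℂ] M} (h : ∀ x y, S (tmul E F x y) = T (tmul E F x y)) :
    S = T :=
  HilbertTensor.ext_tmul h

variable (E F) in
theorem closure_span_tmul :
    (Submodule.span ℂ {z : HTensor E F | ∃ x y, z = tmul E F x y}).topologicalClosure = ⊤ :=
  HilbertTensor.closure_span_tmul E F

variable (G) in
theorem norm_ampl_le (a : E →L[ℂ] F) : ‖ampl G a‖ ≤ ‖a‖ := HilbertTensor.norm_ampl_le G a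

theorem eq_zero_of_inner_tmul {z : HTensor E F} (h : ∀ x y, ⟪tmul E F x y, z⟫_ℂ = 0) :
    z = 0 := by
  have h0 : innerSL ℂ z = 0 := ext_tmul fun x y => by
    rw [innerSL_apply_apply, ← inner_conj_symm, h]
    simp
  have : ⟪z, z⟫_ℂ = 0 := by rw [← innerSL_apply_apply ℂ z z, h0]; rfl
  exact inner_self_eq_zero.1 this

variable (E F G) in
/-- Amplification `a ↦ a ⊗ id` as a continuous linear map. -/
def amplL : (E →L[ℂ] F) →L[ℂ] (HTensor E G →L[ℂ] HTensor F G) :=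
  LinearMap.mkContinuous
    { toFun := ampl G
      map_add' := fun a b => ext_tmul fun x y => by simp [ampl_tmul]
      map_smul' := fun c a => ext_tmul fun x y => by simp [ampl_tmul] }
    1 fun a => by simpa using norm_ampl_le G a

@[simp] theorem amplL_apply (a : E →L[ℂ] F) : amplL E F G a = ampl G a := rfl

theorem ampl_comp (a : F →L[ℂ] K) (b : E →L[ℂ] F) :
    ampl G (a.comp b) = (ampl G a).comp (ampl G b) :=
  ext_tmul fun x y => by simp [ampl_tmul]

variable (E G) in
theorem ampl_id : ampl G (ContinuousLinearMap.id ℂ E) = ContinuousLinearMap.id ℂ _ :=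
  ext_tmul fun x y => by simp [ampl_tmul]

/-- `(a ⊗ id) T_x = T_{a x}` for the creation operators `T_x = x ⊗ ·`. -/
theorem ampl_comp_tmul (a : E →L[ℂ] F) (x : E) :
    (ampl G a).comp (tmul E G x) = tmul F G (a x) := by
  ext y
  simp [ampl_tmul]

/-- `(T_x ⊗ id) T_y = T_{x ⊗ y}`. -/
theorem ampl_tmul_comp_tmul (x : E) (y : F) :
    (ampl G (tmul E F x)).comp (tmul F G y) = tmul (HTensor E F) G (tmul E F x y) :=
  ampl_comp_tmul _ _

theorem adjoint_ampl [CompleteSpace E] [CompleteSpace F] (a : E →L[ℂ] F) :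
    adjoint (ampl G a) = ampl G (adjoint a) := by
  refine ext_tmul fun x y => ?_
  refine sub_eq_zero.1 (eq_zero_of_inner_tmul fun x' y' => ?_)
  rw [inner_sub_right, ContinuousLinearMap.adjoint_inner_right, ampl_tmul, ampl_tmul,
    inner_tmul_tmul, inner_tmul_tmul, ContinuousLinearMap.adjoint_inner_right, sub_self]

theorem adjoint_tmul_comp_tmul [CompleteSpace F] (x y : E) :
    (adjoint (tmul E F x)).comp (tmul E F y) = ⟪x, y⟫_ℂ • ContinuousLinearMap.id ℂ F := by
  ext z
  refine ext_inner_left ℂ fun z' => ?_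
  simp [ContinuousLinearMap.adjoint_inner_right, inner_tmul_tmul, inner_smul_right]

theorem adjoint_ampl_tmul_comp_ampl_tmul [CompleteSpace F] (x y : E) :
    (adjoint (ampl G (tmul E F x))).comp (ampl G (tmul E F y)) =
      ⟪x, y⟫_ℂ • ContinuousLinearMap.id ℂ (HTensor F G) := by
  rw [adjoint_ampl, ← ampl_comp, adjoint_tmul_comp_tmul, ← amplL_apply,
    (amplL F F G).map_smul, amplL_apply, ampl_id]

/-- `T_x T_y* = |x⟩⟨y| ⊗ id`. -/
theorem tmul_comp_adjoint_tmul [CompleteSpace F] (x y : E) :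
    (tmul E F x).comp (adjoint (tmul E F y)) = ampl F (InnerProductSpace.rankOne ℂ x y) := by
  refine ext_tmul fun z t => ?_
  have := congrArg (fun S : F →L[ℂ] F => S t) (adjoint_tmul_comp_tmul (F := F) y z)
  simp only [ContinuousLinearMap.comp_apply] at this
  simp [this, ampl_tmul]

end HTensor

open HTensor

/-! ### Products of closed spaces of operators -/

section SpanCalculus

variable {E F G K E' F' : Type*}
  [NormedAddCommGroup E] [InnerProductSpace ℂ E]
  [NormedAddCommGroup F] [InnerProductSpace ℂ F]
  [NormedAddCommGroup G] [InnerProductSpace ℂ G]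
  [NormedAddCommGroup K] [InnerProductSpace ℂ K]
  [NormedAddCommGroup E'] [InnerProductSpace ℂ E']
  [NormedAddCommGroup F'] [InnerProductSpace ℂ F']

theorem subset_closedSpan (A : Set (E →L[ℂ] F)) : A ⊆ closedSpan A :=
  Submodule.subset_span.trans (Submodule.le_topologicalClosure _)

theorem isClosed_closedSpan (A : Set (E →L[ℂ] F)) :
    IsClosed (closedSpan A : Set (E →L[ℂ] F)) :=
  Submodule.isClosed_topologicalClosure _

theorem closedSpan_le {A : Set (E →L[ℂ] F)} {P : Submodule ℂ (E →L[ℂ] F)}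
    (hP : IsClosed (P : Set (E →L[ℂ] F))) (h : A ⊆ P) : closedSpan A ≤ P :=
  Submodule.topologicalClosure_minimal _ (Submodule.span_le.2 h) hP

theorem closedSpan_mono {A B : Set (E →L[ℂ] F)} (h : A ⊆ B) : closedSpan A ≤ closedSpan B :=
  closedSpan_le (isClosed_closedSpan B) (h.trans (subset_closedSpan B))

theorem closedSpan_coe {P : Submodule ℂ (E →L[ℂ] F)}
    (hP : IsClosed (P : Set (E →L[ℂ] F))) : closedSpan (P : Set (E →L[ℂ] F)) = P :=
  le_antisymm (closedSpan_le hP subset_rfl) (subset_closedSpan _)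

theorem map_mem_closedSpan_image {σ : ℂ →+* ℂ} [RingHomSurjective σ]
    (f : (E →L[ℂ] F) →SL[σ] (E' →L[ℂ] F'))
    {A : Set (E →L[ℂ] F)} {x : E →L[ℂ] F} (hx : x ∈ closedSpan A) :
    f x ∈ closedSpan (f '' A) := by
  have : closedSpan A ≤ (closedSpan (f '' A)).comap (f : (E →L[ℂ] F) →ₛₗ[σ] (E' →L[ℂ] F')) :=
    closedSpan_le ((isClosed_closedSpan _).preimage f.continuous)
      fun a ha => subset_closedSpan _ ⟨a, ha, rfl⟩
  exact this hx

theorem closedSpan_image_closedSpan {σ : ℂ →+* ℂ} [RingHomSurjective σ]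
    (f : (E →L[ℂ] F) →SL[σ] (E' →L[ℂ] F')) (A : Set (E →L[ℂ] F)) :
    closedSpan (f '' closedSpan A) = closedSpan (f '' A) := by
  refine le_antisymm (closedSpan_le (isClosed_closedSpan _) ?_)
    (closedSpan_mono (Set.image_mono (subset_closedSpan A)))
  rintro _ ⟨x, hx, rfl⟩
  exact map_mem_closedSpan_image f hx

/-- The product `[S T]` of two spaces of operators: the closed linear span of the composites. -/
def cmul (S : Submodule ℂ (F →L[ℂ] G)) (T : Submodule ℂ (E →L[ℂ] F)) :
    Submodule ℂ (E →L[ℂ] G) :=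
  closedSpan {x | ∃ s ∈ S, ∃ t ∈ T, x = s.comp t}

infixr:70 " ⋆ " => cmul

theorem comp_mem_cmul {S : Submodule ℂ (F →L[ℂ] G)} {T : Submodule ℂ (E →L[ℂ] F)}
    {s : F →L[ℂ] G} {t : E →L[ℂ] F} (hs : s ∈ S) (ht : t ∈ T) : s.comp t ∈ S ⋆ T :=
  subset_closedSpan _ ⟨s, hs, t, ht, rfl⟩

theorem isClosed_cmul (S : Submodule ℂ (F →L[ℂ] G)) (T : Submodule ℂ (E →L[ℂ] F)) :
    IsClosed ((S ⋆ T : Submodule ℂ (E →L[ℂ] G)) : Set (E →L[ℂ] G)) :=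
  isClosed_closedSpan _

/-- The product of two closed spans is spanned by the products of the generators. -/
theorem closedSpan_cmul_closedSpan (A : Set (F →L[ℂ] G)) (B : Set (E →L[ℂ] F)) :
    closedSpan A ⋆ closedSpan B = closedSpan {x | ∃ a ∈ A, ∃ b ∈ B, x = a.comp b} := by
  refine le_antisymm (closedSpan_le (isClosed_closedSpan _) ?_) (closedSpan_mono ?_)
  · rintro _ ⟨s, hs, t, ht, rfl⟩
    -- first extend in the right factor, for a fixed generator on the left
    have h1 : ∀ a ∈ A, a.comp t ∈ closedSpan {x | ∃ a ∈ A, ∃ b ∈ B, x = a.comp b} := by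
      intro a ha
      refine closedSpan_mono ?_
        (map_mem_closedSpan_image (ContinuousLinearMap.compL ℂ E F G a) ht)
      rintro _ ⟨b, hb, rfl⟩
      exact ⟨a, ha, b, hb, rfl⟩
    have h2 := map_mem_closedSpan_image ((ContinuousLinearMap.compL ℂ E F G).flip t) hs
    refine closedSpan_le (isClosed_closedSpan _) ?_ h2
    rintro _ ⟨a, ha, rfl⟩
    exact h1 a ha
  · rintro _ ⟨a, ha, b, hb, rfl⟩
    exact ⟨a, subset_closedSpan _ ha, b, subset_closedSpan _ hb, rfl⟩

theorem cmul_closedSpan (S : Submodule ℂ (F →L[ℂ] G)) (B : Set (E →L[ℂ] F)) :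
    S ⋆ closedSpan B = closedSpan {x | ∃ a ∈ S, ∃ b ∈ B, x = a.comp b} := by
  refine le_antisymm (closedSpan_le (isClosed_closedSpan _) ?_) (closedSpan_mono ?_)
  · rintro _ ⟨s, hs, t, ht, rfl⟩
    refine closedSpan_mono ?_
      (map_mem_closedSpan_image (ContinuousLinearMap.compL ℂ E F G s) ht)
    rintro _ ⟨b, hb, rfl⟩
    exact ⟨s, hs, b, hb, rfl⟩
  · rintro _ ⟨a, ha, b, hb, rfl⟩
    exact ⟨a, ha, b, subset_closedSpan _ hb, rfl⟩

theorem closedSpan_cmul (A : Set (F →L[ℂ] G)) (T : Submodule ℂ (E →L[ℂ] F)) :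
    closedSpan A ⋆ T = closedSpan {x | ∃ a ∈ A, ∃ b ∈ T, x = a.comp b} := by
  refine le_antisymm (closedSpan_le (isClosed_closedSpan _) ?_) (closedSpan_mono ?_)
  · rintro _ ⟨s, hs, t, ht, rfl⟩
    refine closedSpan_mono ?_
      (map_mem_closedSpan_image ((ContinuousLinearMap.compL ℂ E F G).flip t) hs)
    rintro _ ⟨a, ha, rfl⟩
    exact ⟨a, ha, t, ht, rfl⟩
  · rintro _ ⟨a, ha, b, hb, rfl⟩
    exact ⟨a, subset_closedSpan _ ha, b, hb, rfl⟩

theorem cmul_assoc (S : Submodule ℂ (G →L[ℂ] K)) (T : Submodule ℂ (F →L[ℂ] G))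
    (R : Submodule ℂ (E →L[ℂ] F)) : (S ⋆ T) ⋆ R = S ⋆ T ⋆ R := by
  change closedSpan _ ⋆ R = S ⋆ closedSpan _
  rw [closedSpan_cmul, cmul_closedSpan]
  congr 1
  ext x
  constructor
  · rintro ⟨_, ⟨s, hs, t, ht, rfl⟩, r, hr, rfl⟩
    exact ⟨s, hs, _, ⟨t, ht, r, hr, rfl⟩, rfl⟩
  · rintro ⟨s, hs, _, ⟨t, ht, r, hr, rfl⟩, rfl⟩
    exact ⟨_, ⟨s, hs, t, ht, rfl⟩, r, hr, rfl⟩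

/-- Rewriting with `[S T] = R` at the left end of a right-nested product. -/
theorem cmul_congr_left {S : Submodule ℂ (G →L[ℂ] K)} {T : Submodule ℂ (F →L[ℂ] G)}
    {R : Submodule ℂ (F →L[ℂ] K)} (h : S ⋆ T = R) (Q : Submodule ℂ (E →L[ℂ] F)) :
    S ⋆ T ⋆ Q = R ⋆ Q := by
  rw [← cmul_assoc, h]

/-- The line spanned by a single operator. -/
def line (X : E →L[ℂ] F) : Submodule ℂ (E →L[ℂ] F) := closedSpan {X}

theorem line_cmul_line (X : F →L[ℂ] G) (Y : E →L[ℂ] F) :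
    line X ⋆ line Y = line (X.comp Y) := by
  rw [line, line, closedSpan_cmul_closedSpan, line]
  congr 1
  ext x
  simp

theorem closedSpan_line_cmul (X : F →L[ℂ] G) (B : Set (E →L[ℂ] F)) :
    line X ⋆ closedSpan B = closedSpan {x | ∃ b ∈ B, x = X.comp b} := by
  rw [line, closedSpan_cmul_closedSpan]
  simp

theorem closedSpan_cmul_line (A : Set (F →L[ℂ] G)) (Y : E →L[ℂ] F) :
    closedSpan A ⋆ line Y = closedSpan {x | ∃ a ∈ A, x = a.comp Y} := by
  rw [line, closedSpan_cmul_closedSpan]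
  simp

/-- Commutation with a single operator can be checked on generators. -/
theorem line_cmul_closedSpan_comm {X : E →L[ℂ] E} {Y : F →L[ℂ] F} {A : Set (E →L[ℂ] F)}
    (h : ∀ a ∈ A, Y.comp a = a.comp X) : line Y ⋆ closedSpan A = closedSpan A ⋆ line X := by
  rw [closedSpan_line_cmul, closedSpan_cmul_line]
  congr 1
  ext z
  constructor
  · rintro ⟨a, ha, rfl⟩
    exact ⟨a, ha, h a ha⟩
  · rintro ⟨a, ha, rfl⟩
    exact ⟨a, ha, (h a ha).symm⟩

theorem line_id_cmul {S : Submodule ℂ (E →L[ℂ] F)} (hS : IsClosed (S : Set (E →L[ℂ] F))) :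
    line (ContinuousLinearMap.id ℂ F) ⋆ S = S := by
  rw [line, closedSpan_cmul]
  simpa using closedSpan_coe hS

/-- The closed span of the adjoints of the operators in `S`. -/
def adjS [CompleteSpace E] [CompleteSpace F] (S : Submodule ℂ (E →L[ℂ] F)) :
    Submodule ℂ (F →L[ℂ] E) :=
  closedSpan ((adjoint : (E →L[ℂ] F) → (F →L[ℂ] E)) '' S)

theorem adjS_closedSpan [CompleteSpace E] [CompleteSpace F] (A : Set (E →L[ℂ] F)) :
    adjS (closedSpan A) = closedSpan ((adjoint : (E →L[ℂ] F) → (F →L[ℂ] E)) '' A) :=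
  closedSpan_image_closedSpan
    ((adjoint : (E →L[ℂ] F) ≃ₗᵢ⋆[ℂ] (F →L[ℂ] E)).toContinuousLinearEquiv :
      (E →L[ℂ] F) →L⋆[ℂ] (F →L[ℂ] E)) A

theorem adjoint_mem_adjS [CompleteSpace E] [CompleteSpace F] {S : Submodule ℂ (E →L[ℂ] F)}
    {s : E →L[ℂ] F} (hs : s ∈ S) : adjoint s ∈ adjS S :=
  subset_closedSpan _ ⟨s, hs, rfl⟩

theorem adjS_line [CompleteSpace E] [CompleteSpace F] (X : E →L[ℂ] F) :
    adjS (line X) = line (adjoint X) := by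
  rw [line, adjS_closedSpan, Set.image_singleton, line]

theorem adjS_adjS [CompleteSpace E] [CompleteSpace F] {S : Submodule ℂ (E →L[ℂ] F)}
    (hS : IsClosed (S : Set (E →L[ℂ] F))) : adjS (adjS S) = S := by
  change adjS (closedSpan _) = S
  rw [adjS_closedSpan, Set.image_image]
  simpa using closedSpan_coe hS

theorem adjS_cmul [CompleteSpace E] [CompleteSpace F] [CompleteSpace G]
    (S : Submodule ℂ (F →L[ℂ] G)) (T : Submodule ℂ (E →L[ℂ] F)) :
    adjS (S ⋆ T) = adjS T ⋆ adjS S := by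
  rw [cmul, adjS_closedSpan, adjS, adjS, closedSpan_cmul_closedSpan]
  congr 1
  ext x
  constructor
  · rintro ⟨_, ⟨s, hs, t, ht, rfl⟩, rfl⟩
    exact ⟨_, ⟨t, ht, rfl⟩, _, ⟨s, hs, rfl⟩, ContinuousLinearMap.adjoint_comp _ _⟩
  · rintro ⟨_, ⟨t, ht, rfl⟩, _, ⟨s, hs, rfl⟩, rfl⟩
    exact ⟨_, ⟨s, hs, t, ht, rfl⟩, ContinuousLinearMap.adjoint_comp _ _⟩

variable (G) in
/-- `[S ⊗ id_G]`, the amplification of a space of operators. -/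
def amplS (S : Submodule ℂ (E →L[ℂ] F)) :
    Submodule ℂ (HTensor E G →L[ℂ] HTensor F G) :=
  closedSpan (ampl G '' S)

theorem amplS_closedSpan (A : Set (E →L[ℂ] F)) :
    amplS G (closedSpan A) = closedSpan (ampl G '' A) :=
  closedSpan_image_closedSpan (amplL E F G) A

theorem amplS_line (X : E →L[ℂ] F) : amplS G (line X) = line (ampl G X) := by
  rw [line, amplS_closedSpan, Set.image_singleton, line]

theorem amplS_cmul (S : Submodule ℂ (F →L[ℂ] K)) (T : Submodule ℂ (E →L[ℂ] F)) :
    amplS G (S ⋆ T) = amplS G S ⋆ amplS G T := by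
  rw [cmul, amplS_closedSpan, amplS, amplS, closedSpan_cmul_closedSpan]
  congr 1
  ext x
  constructor
  · rintro ⟨_, ⟨s, hs, t, ht, rfl⟩, rfl⟩
    exact ⟨_, ⟨s, hs, rfl⟩, _, ⟨t, ht, rfl⟩, ampl_comp _ _⟩
  · rintro ⟨_, ⟨s, hs, rfl⟩, _, ⟨t, ht, rfl⟩, rfl⟩
    exact ⟨_, ⟨s, hs, t, ht, rfl⟩, ampl_comp _ _⟩

theorem adjS_amplS [CompleteSpace E] [CompleteSpace F] (S : Submodule ℂ (E →L[ℂ] F)) :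
    adjS (amplS G S) = amplS G (adjS S) := by
  rw [amplS, adjS_closedSpan, adjS, amplS_closedSpan, Set.image_image, Set.image_image]
  simp only [adjoint_ampl]

end SpanCalculus

section Creation

variable (E F G : Type*)
  [NormedAddCommGroup E] [InnerProductSpace ℂ E]
  [NormedAddCommGroup F] [InnerProductSpace ℂ F]
  [NormedAddCommGroup G] [InnerProductSpace ℂ G]

/-- The space of creation operators `T_x : F → E ⊗ F`, `y ↦ x ⊗ y`, for `x ∈ E`. -/
def creations : Submodule ℂ (F →L[ℂ] HTensor E F) :=
  closedSpan (Set.range (tmul E F))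

theorem isClosed_creations :
    IsClosed (creations E F : Set (F →L[ℂ] HTensor E F)) :=
  isClosed_closedSpan _

/-- Creating on two legs at once is creating on one leg after the other. -/
theorem amplS_creations_cmul :
    amplS G (creations E F) ⋆ creations F G = creations (HTensor E F) G := by
  rw [creations, creations, amplS_closedSpan, closedSpan_cmul_closedSpan]
  refine le_antisymm (closedSpan_mono ?_) (closedSpan_le (isClosed_closedSpan _) ?_)
  · rintro _ ⟨_, ⟨_, ⟨x, rfl⟩, rfl⟩, _, ⟨y, rfl⟩, rfl⟩
    exact ⟨_, (ampl_tmul_comp_tmul x y).symm⟩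
  · rintro _ ⟨z, rfl⟩
    -- elementary tensors span a dense subspace of `E ⊗ F`
    have hz : z ∈ (Submodule.span ℂ {z : HTensor E F | ∃ x y, z = tmul E F x y}
        ).topologicalClosure := by rw [closure_span_tmul]; trivial
    refine (Submodule.topologicalClosure_minimal
      (t := Submodule.comap (tmul (HTensor E F) G).toLinearMap (closedSpan _)) _
      (Submodule.span_le.2 ?_)
      ((isClosed_closedSpan _).preimage (tmul (HTensor E F) G).continuous)) hz
    rintro _ ⟨x, y, rfl⟩
    exact subset_closedSpan _
      ⟨_, ⟨_, ⟨x, rfl⟩, rfl⟩, _, ⟨y, rfl⟩, (ampl_tmul_comp_tmul x y).symm⟩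

variable {E F G}

theorem line_ampl_cmul_creations {U V : E →L[ℂ] E} (hUV : U.comp V = ContinuousLinearMap.id ℂ E) :
    line (ampl F U) ⋆ creations E F = creations E F := by
  rw [creations, closedSpan_line_cmul]
  congr 1
  ext x
  constructor
  · rintro ⟨_, ⟨y, rfl⟩, rfl⟩
    exact ⟨U y, (ampl_comp_tmul _ _).symm⟩
  · rintro ⟨y, rfl⟩
    refine ⟨_, ⟨V y, rfl⟩, ?_⟩
    rw [ampl_comp_tmul]
    exact congrArg _ (congrArg (fun S : E →L[ℂ] E => S y) hUV).symm

theorem adjS_creations_cmul_creations [CompleteSpace F] [Nontrivial E] :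
    adjS (creations E F) ⋆ creations E F = line (ContinuousLinearMap.id ℂ F) := by
  rw [creations, adjS_closedSpan, closedSpan_cmul_closedSpan]
  refine le_antisymm (closedSpan_le (isClosed_closedSpan _) ?_)
    (closedSpan_le (isClosed_closedSpan _) ?_)
  · rintro _ ⟨_, ⟨_, ⟨x, rfl⟩, rfl⟩, _, ⟨y, rfl⟩, rfl⟩
    rw [adjoint_tmul_comp_tmul]
    exact Submodule.smul_mem _ _ (subset_closedSpan _ rfl)
  · rintro _ rfl
    obtain ⟨x, hx⟩ := exists_ne (0 : E)
    have hx' : ⟪x, x⟫_ℂ ≠ 0 := fun h => hx (inner_self_eq_zero.1 h)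
    have := Submodule.smul_mem _ (⟪x, x⟫_ℂ)⁻¹ (subset_closedSpan
      {z | ∃ a ∈ (adjoint : (F →L[ℂ] HTensor E F) → _) '' Set.range (tmul E F),
        ∃ b ∈ Set.range (tmul E F), z = a.comp b}
      ⟨_, ⟨_, ⟨x, rfl⟩, rfl⟩, _, ⟨x, rfl⟩, (adjoint_tmul_comp_tmul x x).symm⟩)
    rwa [smul_smul, inv_mul_cancel₀ hx', one_smul] at this

theorem creations_cmul_adjS_creations [CompleteSpace F] :
    creations E F ⋆ adjS (creations E F) =
      amplS F (closedSpan {k | ∃ x y : E, k = InnerProductSpace.rankOne ℂ x y}) := by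
  rw [creations, adjS_closedSpan, closedSpan_cmul_closedSpan, amplS_closedSpan]
  congr 1
  ext z
  constructor
  · rintro ⟨_, ⟨x, rfl⟩, _, ⟨_, ⟨y, rfl⟩, rfl⟩, rfl⟩
    exact ⟨_, ⟨x, y, rfl⟩, (tmul_comp_adjoint_tmul x y).symm⟩
  · rintro ⟨_, ⟨x, y, rfl⟩, rfl⟩
    exact ⟨_, ⟨x, rfl⟩, _, ⟨_, ⟨y, rfl⟩, rfl⟩, (tmul_comp_adjoint_tmul x y).symm⟩

/-- The space of left slices of `X` is `[T_x* X T_y | x, y]`. -/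
theorem leftSlices_eq [CompleteSpace E] [CompleteSpace F]
    (X : HilbertTensor E F →L[ℂ] HilbertTensor E F) :
    leftSlices X = adjS (creations E F) ⋆ line (ofHilbertTensor X) ⋆ creations E F := by
  rw [creations, adjS_closedSpan, closedSpan_line_cmul, closedSpan_cmul_closedSpan, leftSlices]
  have key : ∀ x y : E, sliceLeft (vectorFunctional x y) X =
      (adjoint (tmul E F x)).comp ((ofHilbertTensor X).comp (tmul E F y)) := by
    intro x y
    ext z
    refine ext_inner_left ℂ fun z' => ?_
    rw [sliceLeft, inner_sliceOf]
    trans ⟪HilbertTensor.tmul E F x z', X (HilbertTensor.tmul E F y z)⟫_ℂ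
    · simp [vectorFunctional, ContinuousLinearMap.adjoint_inner_right]
    · exact (ContinuousLinearMap.adjoint_inner_right (tmul E F x) z' _).symm
  refine le_antisymm (closedSpan_le (isClosed_closedSpan _) ?_) (closedSpan_mono ?_)
  · rintro _ ⟨ω, hω, rfl⟩
    -- slicing is linear and norm continuous in the functional
    let f : StrongDual ℂ (E →L[ℂ] E) →L[ℂ] (F →L[ℂ] F) := LinearMap.mkContinuous
      { toFun := fun ω => sliceLeft ω X
        map_add' := fun ω ω' => by
          ext z
          refine ext_inner_left ℂ fun z' => ?_
          simp [sliceLeft, inner_sliceOf, inner_add_right]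
        map_smul' := fun c ω => by
          ext z
          refine ext_inner_left ℂ fun z' => ?_
          simp [sliceLeft, inner_sliceOf, inner_smul_right] }
      (‖(HilbertTensor.tmul E F).flip‖ * ‖X‖ * ‖(HilbertTensor.tmul E F).flip‖) fun ω => by
        have h : ‖sliceLeft ω X‖ ≤ ‖ω‖ * ‖(HilbertTensor.tmul E F).flip‖ * ‖X‖ *
            ‖(HilbertTensor.tmul E F).flip‖ := by
          unfold sliceLeft sliceOf
          exact LinearMap.mkContinuous_norm_le _ (by positivity) _
        exact h.trans (le_of_eq (by ring))
    refine (Submodule.topologicalClosure_minimal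
      (t := Submodule.comap f.toLinearMap (closedSpan _)) _
      (Submodule.span_le.2 ?_) ((isClosed_closedSpan _).preimage f.continuous)) hω
    rintro _ ⟨⟨x, y⟩, rfl⟩
    exact subset_closedSpan _ ⟨_, ⟨_, ⟨x, rfl⟩, rfl⟩, _, ⟨_, ⟨y, rfl⟩, rfl⟩, key x y⟩
  · rintro _ ⟨_, ⟨_, ⟨x, rfl⟩, rfl⟩, _, ⟨_, ⟨y, rfl⟩, rfl⟩, rfl⟩
    exact ⟨vectorFunctional x y, Submodule.le_topologicalClosure _
      (Submodule.subset_span ⟨(x, y), rfl⟩), (key x y).symm⟩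

/-- The compact operators on a Hilbert space are the closed span of the rank one operators. -/
theorem compacts_eq [CompleteSpace E] :
    compacts E E = closedSpan {k | ∃ x y : E, k = InnerProductSpace.rankOne ℂ x y} := by
  refine le_antisymm (fun T hT => ?_) (closedSpan_le ?_ ?_)
  · have hT' : IsCompactOperator T := hT
    refine Metric.mem_closure_iff.2 fun ε hε => ?_
    have hc := hT'.isCompact_closure_image_closedBall (𝕜₁ := ℂ) 1
    obtain ⟨t, htf, ht⟩ := Metric.totallyBounded_iff.1 hc.totallyBounded (ε / 2) (half_pos hε)
    -- project onto the span of an `ε/2`-net of the image of the unit ball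
    let U : Submodule ℂ E := Submodule.span ℂ t
    have : FiniteDimensional ℂ U := FiniteDimensional.span_of_finite ℂ htf
    refine ⟨U.starProjection.comp T, ?_, ?_⟩
    · rw [(stdOrthonormalBasis ℂ U).starProjection_eq_sum_rankOne,
        ContinuousLinearMap.finsetSum_comp]
      refine Submodule.sum_mem _ fun i _ => Submodule.subset_span ?_
      exact ⟨_, _, InnerProductSpace.rankOne_comp _ _ _⟩
    · rw [dist_eq_norm]
      refine lt_of_le_of_lt (ContinuousLinearMap.opNorm_le_of_unit_norm (half_pos hε).le
        fun x hx => ?_) (half_lt_self hε)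
      have hx' : T x ∈ closure (T '' Metric.closedBall 0 1) :=
        subset_closure ⟨x, by simp [hx], rfl⟩
      obtain ⟨y, hy, hxy⟩ := Set.mem_iUnion₂.1 (ht hx')
      have hmin : ‖T x - U.starProjection (T x)‖ ≤ ‖T x - y‖ := by
        rw [Submodule.starProjection_minimal]
        exact ciInf_le ⟨0, by rintro _ ⟨z, rfl⟩; positivity⟩
          (⟨y, Submodule.subset_span hy⟩ : U)
      rw [Metric.mem_ball, dist_eq_norm] at hxy
      exact hmin.trans hxy.le
  · exact isClosed_setOfPred_isCompactOperator
  · rintro _ ⟨x, y, rfl⟩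
    have h1 : IsCompactOperator (id : ℂ → ℂ) :=
      (isCompactOperator_id_iff_finiteDimensional (𝕜 := ℂ)).2 inferInstance
    exact (h1.clm_comp (ContinuousLinearMap.toSpanSingleton ℂ x)).comp_clm (innerSL ℂ y)

end Creation

-- From here on these spaces are manipulated through the calculus above only.
attribute [irreducible] cmul line adjS amplS creations

/-! ### Unitary operators and their legs -/

section UnitaryLines

variable {E : Type*} [NormedAddCommGroup E] [InnerProductSpace ℂ E] [CompleteSpace E]

/-- The line spanned by a unitary operator. -/
def uline (u : unitary (E →L[ℂ] E)) : Submodule ℂ (E →L[ℂ] E) := line (u : E →L[ℂ] E)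

theorem uline_mul (u v : unitary (E →L[ℂ] E)) : uline (u * v) = uline u ⋆ uline v :=
  (line_cmul_line _ _).symm

theorem adjS_uline (u : unitary (E →L[ℂ] E)) : adjS (uline u) = uline u⁻¹ :=
  adjS_line _

theorem uline_inv_cmul_uline_cmul {F : Type*} [NormedAddCommGroup F] [InnerProductSpace ℂ F]
    (u : unitary (E →L[ℂ] E)) {S : Submodule ℂ (F →L[ℂ] E)}
    (hS : IsClosed (S : Set (F →L[ℂ] E))) : uline u⁻¹ ⋆ uline u ⋆ S = S := by
  rw [← cmul_assoc, ← uline_mul, inv_mul_cancel]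
  exact line_id_cmul hS

theorem uline_cmul_uline_inv_cmul {F : Type*} [NormedAddCommGroup F] [InnerProductSpace ℂ F]
    (u : unitary (E →L[ℂ] E)) {S : Submodule ℂ (F →L[ℂ] E)}
    (hS : IsClosed (S : Set (F →L[ℂ] E))) : uline u ⋆ uline u⁻¹ ⋆ S = S := by
  simpa using uline_inv_cmul_uline_cmul u⁻¹ hS

variable {F : Type*} [NormedAddCommGroup F] [InnerProductSpace ℂ F] [CompleteSpace F]

theorem mul_intertwines {u v : unitary (E →L[ℂ] E)} {u' v' : unitary (F →L[ℂ] F)} {T : E →L[ℂ] F}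
    (h : (u' : F →L[ℂ] F).comp T = T.comp (u : E →L[ℂ] E))
    (h' : (v' : F →L[ℂ] F).comp T = T.comp (v : E →L[ℂ] E)) :
    ((u' * v' : unitary (F →L[ℂ] F)) : F →L[ℂ] F).comp T =
      T.comp ((u * v : unitary (E →L[ℂ] E)) : E →L[ℂ] E) := by
  change ((u' : F →L[ℂ] F).comp (v' : F →L[ℂ] F)).comp T =
    T.comp ((u : E →L[ℂ] E).comp (v : E →L[ℂ] E))
  rw [ContinuousLinearMap.comp_assoc, h', ← ContinuousLinearMap.comp_assoc, h,
    ContinuousLinearMap.comp_assoc]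

theorem inv_intertwines {u : unitary (E →L[ℂ] E)} {u' : unitary (F →L[ℂ] F)} {T : E →L[ℂ] F}
    (h : (u' : F →L[ℂ] F).comp T = T.comp (u : E →L[ℂ] E)) :
    ((u'⁻¹ : unitary (F →L[ℂ] F)) : F →L[ℂ] F).comp T =
      T.comp ((u⁻¹ : unitary (E →L[ℂ] E)) : E →L[ℂ] E) := by
  have h1 : (u : E →L[ℂ] E).comp ((u⁻¹ : unitary (E →L[ℂ] E)) : E →L[ℂ] E) =
      ContinuousLinearMap.id ℂ E := congrArg Subtype.val (mul_inv_cancel u)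
  have h2 : ((u'⁻¹ : unitary (F →L[ℂ] F)) : F →L[ℂ] F).comp (u' : F →L[ℂ] F) =
      ContinuousLinearMap.id ℂ F := congrArg Subtype.val (inv_mul_cancel u')
  calc ((u'⁻¹ : unitary (F →L[ℂ] F)) : F →L[ℂ] F).comp T
      = ((u'⁻¹ : unitary (F →L[ℂ] F)) : F →L[ℂ] F).comp
          ((T.comp (u : E →L[ℂ] E)).comp ((u⁻¹ : unitary (E →L[ℂ] E)) : E →L[ℂ] E)) := by
        rw [ContinuousLinearMap.comp_assoc, h1, ContinuousLinearMap.comp_id]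
    _ = _ := by
        rw [← h, ContinuousLinearMap.comp_assoc, ← ContinuousLinearMap.comp_assoc, h2,
          ContinuousLinearMap.id_comp]

variable (E) in
/-- Amplification of unitary operators, as a group homomorphism. -/
def amplU (G : Type*) [NormedAddCommGroup G] [InnerProductSpace ℂ G] [CompleteSpace G] :
    unitary (E →L[ℂ] E) →* unitary (HTensor E G →L[ℂ] HTensor E G) where
  toFun u := ⟨ampl G (u : E →L[ℂ] E), by
    have h : ∀ v : E →L[ℂ] E, star (ampl G v) = ampl G (star v) := adjoint_ampl
    have h' : ∀ v w : E →L[ℂ] E, ampl G v * ampl G w = ampl G (v * w) :=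
      fun v w => (ampl_comp v w).symm
    have h1 : ampl G (1 : E →L[ℂ] E) = 1 := ampl_id E G
    have hu : (u : E →L[ℂ] E) * star (u : E →L[ℂ] E) = 1 := Unitary.mul_star_self_of_mem u.2
    exact Unitary.mem_iff.2 ⟨by rw [h, h', Unitary.coe_star_mul_self, h1],
      by rw [h, h', hu, h1]⟩⟩
  map_one' := Subtype.ext (ampl_id E G)
  map_mul' u v := Subtype.ext (ampl_comp (u : E →L[ℂ] E) (v : E →L[ℂ] E))

theorem amplS_uline {G : Type*} [NormedAddCommGroup G] [InnerProductSpace ℂ G] [CompleteSpace G]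
    (u : unitary (E →L[ℂ] E)) : amplS G (uline u) = uline (amplU E G u) :=
  amplS_line _

end UnitaryLines

section Legs

variable {H : Type*} [NormedAddCommGroup H] [InnerProductSpace ℂ H]

/-- `Y` is the operator `X₂₃ = id ⊗ X` on `(H ⊗ H) ⊗ H`: it intertwines `X` along all creation
operators on the first leg. -/
def IsRightLeg (X : unitary (HTensor H H →L[ℂ] HTensor H H))
    (Y : unitary (HTensor (HTensor H H) H →L[ℂ]
      HTensor (HTensor H H) H)) : Prop :=
  ∀ x : H, Y.1.comp (ampl H (tmul H H x)) = (ampl H (tmul H H x)).comp X.1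

variable {X Z : unitary (HTensor H H →L[ℂ] HTensor H H)}
  {Y W : unitary (HTensor (HTensor H H) H →L[ℂ] HTensor (HTensor H H) H)}

theorem IsRightLeg.mul (h : IsRightLeg X Y) (h' : IsRightLeg Z W) :
    IsRightLeg (X * Z) (Y * W) := fun x => mul_intertwines (h x) (h' x)

theorem IsRightLeg.inv (h : IsRightLeg X Y) : IsRightLeg X⁻¹ Y⁻¹ :=
  fun x => inv_intertwines (h x)

variable (H) in
/-- The creation operators `y ⊗ z ↦ (x ⊗ y) ⊗ z` on the first of three legs. -/
def creations₃ : Submodule ℂ (HTensor H H →L[ℂ] HTensor (HTensor H H) H) :=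
  amplS H (creations H H)

local notation "𝓙" => creations H H
local notation "𝓙₃" => creations₃ H
local notation "P" => amplU (HTensor H H) H

theorem creations₃_eq : 𝓙₃ = closedSpan (ampl H '' Set.range (tmul H H)) := by
  rw [creations₃, creations, amplS_closedSpan]

variable (H) in
theorem isClosed_creations₃ :
    IsClosed (𝓙₃ : Set (HTensor H H →L[ℂ] HTensor (HTensor H H) H)) := by
  rw [creations₃_eq]
  exact isClosed_closedSpan _

theorem IsRightLeg.uline_cmul (h : IsRightLeg X Y) : uline Y ⋆ 𝓙₃ = 𝓙₃ ⋆ uline X := by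
  rw [creations₃_eq]
  refine line_cmul_closedSpan_comm ?_
  rintro _ ⟨_, ⟨x, rfl⟩, rfl⟩
  exact h x

theorem IsRightLeg.uline_cmul_cmul (h : IsRightLeg X Y) {E : Type*} [NormedAddCommGroup E]
    [InnerProductSpace ℂ E] (Q : Submodule ℂ (E →L[ℂ] HTensor H H)) :
    uline Y ⋆ 𝓙₃ ⋆ Q = 𝓙₃ ⋆ uline X ⋆ Q := by
  rw [← cmul_assoc, h.uline_cmul, cmul_assoc]

/-- Operators on `(H ⊗ H) ⊗ H` agree if they agree after creation on the first leg. -/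
theorem ext_ampl_tmul {M : Type*} [NormedAddCommGroup M] [NormedSpace ℂ M]
    {S T : HTensor (HTensor H H) H →L[ℂ] M}
    (h : ∀ x : H, S.comp (ampl H (tmul H H x)) = T.comp (ampl H (tmul H H x))) : S = T := by
  refine ext_tmul fun t z => ?_
  have h1 : S.comp ((tmul (HTensor H H) H).flip z) =
      T.comp ((tmul (HTensor H H) H).flip z) := by
    refine ext_tmul fun x y => ?_
    have h2 : S (ampl H (tmul H H x) (tmul H H y z)) = T (ampl H (tmul H H x) (tmul H H y z)) :=
      DFunLike.congr_fun (h x) (tmul H H y z)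
    rw [ampl_tmul] at h2
    exact h2
  exact DFunLike.congr_fun h1 t

theorem IsRightLeg.comp_ampl_ampl (h : IsRightLeg X Y) (s : H →L[ℂ] H) :
    Y.1.comp (ampl H (ampl H s)) = (ampl H (ampl H s)).comp Y.1 := by
  refine ext_ampl_tmul fun x => ?_
  rw [ContinuousLinearMap.comp_assoc, ← ampl_comp, ampl_comp_tmul, h,
    ContinuousLinearMap.comp_assoc, h, ← ContinuousLinearMap.comp_assoc, ← ampl_comp,
    ampl_comp_tmul]

/-- A right leg commutes with amplifications from the first leg. -/
theorem IsRightLeg.uline_cmul_amplS (h : IsRightLeg X Y) (S : Submodule ℂ (H →L[ℂ] H)) :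
    uline Y ⋆ amplS H (amplS H S) = amplS H (amplS H S) ⋆ uline Y := by
  have h1 : amplS H (amplS H S) = closedSpan (ampl H '' (ampl H '' (S : Set (H →L[ℂ] H)))) := by
    rw [← amplS_closedSpan]
    congr 1
    rw [amplS]
  rw [h1]
  refine line_cmul_closedSpan_comm ?_
  rintro _ ⟨_, ⟨s, hs, rfl⟩, rfl⟩
  exact h.comp_ampl_ampl s

theorem IsRightLeg.adjS_cmul (h : IsRightLeg X Y) :
    adjS 𝓙₃ ⋆ uline Y = uline X ⋆ adjS 𝓙₃ := by
  have := congrArg adjS h.inv.uline_cmul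
  rw [_root_.adjS_cmul, _root_.adjS_cmul, adjS_uline, adjS_uline, inv_inv, inv_inv] at this
  exact this

theorem IsRightLeg.adjS_cmul_cmul (h : IsRightLeg X Y) {E : Type*} [NormedAddCommGroup E]
    [InnerProductSpace ℂ E] (Q : Submodule ℂ (E →L[ℂ] HTensor (HTensor H H) H)) :
    adjS 𝓙₃ ⋆ uline Y ⋆ Q = uline X ⋆ adjS 𝓙₃ ⋆ Q := by
  rw [← cmul_assoc, h.adjS_cmul, cmul_assoc]

variable [CompleteSpace H]

/-- Unitaries on the first two legs are absorbed when both legs are created. -/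
theorem uline_amplU_cmul (u : unitary (HTensor H H →L[ℂ] HTensor H H)) :
    uline (P u) ⋆ 𝓙₃ ⋆ 𝓙 = 𝓙₃ ⋆ 𝓙 := by
  rw [creations₃, amplS_creations_cmul]
  exact line_ampl_cmul_creations (V := (u⁻¹ : unitary _).1)
    (congrArg Subtype.val (mul_inv_cancel u))

theorem uline_amplU_inv_cmul (u : unitary (HTensor H H →L[ℂ] HTensor H H)) :
    uline (P u)⁻¹ ⋆ 𝓙₃ ⋆ 𝓙 = 𝓙₃ ⋆ 𝓙 := by
  rw [← map_inv, uline_amplU_cmul]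

theorem adjS_cmul_uline_amplU (u : unitary (HTensor H H →L[ℂ] HTensor H H)) :
    adjS 𝓙 ⋆ adjS 𝓙₃ ⋆ uline (P u) = adjS 𝓙 ⋆ adjS 𝓙₃ := by
  have := congrArg adjS (uline_amplU_inv_cmul u)
  rwa [_root_.adjS_cmul, _root_.adjS_cmul, adjS_uline, inv_inv, cmul_assoc] at this

theorem adjS_cmul_uline_amplU_cmul (u : unitary (HTensor H H →L[ℂ] HTensor H H))
    {E : Type*} [NormedAddCommGroup E] [InnerProductSpace ℂ E]
    (Q : Submodule ℂ (E →L[ℂ] HTensor (HTensor H H) H)) :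
    adjS 𝓙 ⋆ adjS 𝓙₃ ⋆ uline (P u) ⋆ Q = adjS 𝓙 ⋆ adjS 𝓙₃ ⋆ Q := by
  have := congrArg (· ⋆ Q) (adjS_cmul_uline_amplU u)
  simpa only [cmul_assoc] using this

theorem adjS_cmul_uline_amplU_inv_cmul
    (u : unitary (HTensor H H →L[ℂ] HTensor H H))
    {E : Type*} [NormedAddCommGroup E] [InnerProductSpace ℂ E]
    (Q : Submodule ℂ (E →L[ℂ] HTensor (HTensor H H) H)) :
    adjS 𝓙 ⋆ adjS 𝓙₃ ⋆ uline (P u)⁻¹ ⋆ Q = adjS 𝓙 ⋆ adjS 𝓙₃ ⋆ Q := by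
  rw [← map_inv, adjS_cmul_uline_amplU_cmul]

/-- The space `A(X)` of left slices of a unitary. -/
def slices (X : unitary (HTensor H H →L[ℂ] HTensor H H)) :
    Submodule ℂ (H →L[ℂ] H) :=
  adjS 𝓙 ⋆ uline X ⋆ 𝓙

theorem isClosed_slices (X : unitary (HTensor H H →L[ℂ] HTensor H H)) :
    IsClosed (slices X : Set (H →L[ℂ] H)) := isClosed_cmul _ _

theorem amplS_slices (X : unitary (HTensor H H →L[ℂ] HTensor H H)) :
    amplS H (slices X) = adjS 𝓙₃ ⋆ uline (P X) ⋆ 𝓙₃ := by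
  have h1 : amplS H (adjS 𝓙) = adjS 𝓙₃ := (adjS_amplS _).symm
  have h2 : amplS H (uline X) = uline (P X) := amplS_uline X
  have h3 : amplS H 𝓙 = 𝓙₃ := rfl
  rw [slices, amplS_cmul, amplS_cmul, h1, h2, h3]

theorem adjS_slices (X : unitary (HTensor H H →L[ℂ] HTensor H H)) :
    adjS (slices X) = slices X⁻¹ := by
  have h1 : adjS (adjS 𝓙) = 𝓙 := adjS_adjS (isClosed_creations H H)
  rw [slices, _root_.adjS_cmul, _root_.adjS_cmul, adjS_uline, h1, slices, cmul_assoc]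

theorem adjS_compacts : adjS (compacts H H) = compacts H H := by
  rw [compacts_eq, adjS_closedSpan]
  congr 1
  ext z
  constructor
  · rintro ⟨_, ⟨x, y, rfl⟩, rfl⟩
    exact ⟨y, x, InnerProductSpace.adjoint_rankOne x y⟩
  · rintro ⟨x, y, rfl⟩
    exact ⟨_, ⟨y, x, rfl⟩, InnerProductSpace.adjoint_rankOne y x⟩

/-- If the left slices of `X` span the compact operators, then slicing `X ⊗ id` over its first leg
yields the products `T_x T_y*` of creation and annihilation operators on the second leg. -/
theorem adjS_cmul_uline_cmul_of_regular
    {X : unitary (HTensor H H →L[ℂ] HTensor H H)}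
    (h : slices X = compacts H H) {E : Type*} [NormedAddCommGroup E] [InnerProductSpace ℂ E]
    (Q : Submodule ℂ (E →L[ℂ] HTensor H H)) :
    adjS 𝓙₃ ⋆ uline (P X) ⋆ 𝓙₃ ⋆ Q = 𝓙 ⋆ adjS 𝓙 ⋆ Q := by
  have h1 := amplS_slices X
  rw [h, compacts_eq, ← creations_cmul_adjS_creations] at h1
  have := congrArg (· ⋆ Q) h1
  simpa only [cmul_assoc] using this.symm

theorem adjS_creations₃_cmul_creations₃_cmul {E : Type*} [NormedAddCommGroup E]
    [InnerProductSpace ℂ E] {Q : Submodule ℂ (E →L[ℂ] HTensor H H)}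
    (hQ : IsClosed (Q : Set (E →L[ℂ] HTensor H H))) :
    adjS 𝓙₃ ⋆ 𝓙₃ ⋆ Q = Q := by
  rcases subsingleton_or_nontrivial H with hH | hH
  · have h0 : ∀ z : HTensor H H, z = 0 := fun z => eq_zero_of_inner_tmul fun x y => by
      rw [Subsingleton.elim x 0, map_zero, zero_apply, inner_zero_left]
    have : Subsingleton (E →L[ℂ] HTensor H H) :=
      ⟨fun S T => ContinuousLinearMap.ext fun z => by rw [h0 (S z), h0 (T z)]⟩
    exact Subsingleton.elim _ _
  · rw [← cmul_assoc, creations₃, adjS_amplS, ← amplS_cmul, adjS_creations_cmul_creations,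
      amplS_line, ampl_id, line_id_cmul hQ]

end Legs

/-! ### Regular multiplicative unitaries -/

section MultiplicativeUnitaries

variable {H : Type*} [NormedAddCommGroup H] [InnerProductSpace ℂ H] [CompleteSpace H]

local notation "𝓙" => creations H H
local notation "𝓙₃" => creations₃ H
local notation "P" => amplU (HTensor H H) H

/-- A multiplicative unitary `X` on `H ⊗ H` with respect to a unitary `d` playing the role of the
braiding, both equipped with their right legs `X' = X₂₃` and `d' = d₂₃`: the pentagon equation,
naturality of the braiding with respect to `X`, and regularity of `d` and of `X d⁻¹` for left
slices. -/
structure IsRegularMU (d X : unitary (HTensor H H →L[ℂ] HTensor H H))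
    (d' X' : unitary (HTensor (HTensor H H) H →L[ℂ] HTensor (HTensor H H) H)) : Prop where
  leg_braiding : IsRightLeg d d'
  leg : IsRightLeg X X'
  naturality : d' * P d * X' = P X * d' * P d
  pentagon : X' * P X = P X * (P d)⁻¹ * X' * P d * X'
  regular_braiding : slices d = compacts H H
  regular : slices (X * d⁻¹) = compacts H H

namespace IsRegularMU

variable {d X : unitary (HTensor H H →L[ℂ] HTensor H H)}
  {d' X' : unitary (HTensor (HTensor H H) H →L[ℂ] HTensor (HTensor H H) H)}

theorem regular_braiding_inv (h : IsRegularMU d X d' X') : slices d⁻¹ = compacts H H := by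
  rw [← adjS_slices, h.regular_braiding, adjS_compacts]

theorem regular_inv (h : IsRegularMU d X d' X') : slices (d * X⁻¹) = compacts H H := by
  have : d * X⁻¹ = (X * d⁻¹)⁻¹ := by group
  rw [this, ← adjS_slices, h.regular, adjS_compacts]

theorem pentagon₁ (h : IsRegularMU d X d' X') :
    (P d)⁻¹ * (X' * P d * X') = (P X)⁻¹ * X' * P X := by
  have := h.pentagon
  calc (P d)⁻¹ * (X' * P d * X') = (P X)⁻¹ * (P X * (P d)⁻¹ * X' * P d * X') := by group
    _ = _ := by rw [← this]; group

theorem pentagon₂ (h : IsRegularMU d X d' X') :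
    X'⁻¹ * P (X * d⁻¹) * X' = P X * (X'⁻¹ * (P d)⁻¹) := by
  have := h.pentagon
  calc X'⁻¹ * P (X * d⁻¹) * X'
      = X'⁻¹ * (P X * (P d)⁻¹ * X' * P d * X') * X'⁻¹ * (P d)⁻¹ := by
        rw [map_mul, map_inv]; group
    _ = _ := by rw [← this]; group

theorem pentagon₃ (h : IsRegularMU d X d' X') :
    X' * (P d * X' * (P d)⁻¹) = P (d * X⁻¹) * (X' * P (X * d⁻¹)) := by
  have := h.pentagon₁
  calc X' * (P d * X' * (P d)⁻¹) = P d * ((P d)⁻¹ * (X' * P d * X')) * (P d)⁻¹ := by group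
    _ = _ := by rw [this, map_mul, map_mul, map_inv, map_inv]; group

/-- The adjoint form of `pentagon₃`. -/
theorem pentagon₄ (h : IsRegularMU d X d' X') :
    P d * X'⁻¹ * (P d)⁻¹ * X'⁻¹ = P (d * X⁻¹) * (X'⁻¹ * P (X * d⁻¹)) := by
  have := congrArg (·⁻¹) h.pentagon₃
  calc P d * X'⁻¹ * (P d)⁻¹ * X'⁻¹ = (X' * (P d * X' * (P d)⁻¹))⁻¹ := by group
    _ = _ := by rw [this, map_mul, map_mul, map_inv, map_inv]; group

/-- `A(X)` is idempotent: slice the pentagon equation over the first two legs. -/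
theorem slices_cmul_slices (h : IsRegularMU d X d' X') :
    slices X ⋆ slices X = slices X := by
  calc slices X ⋆ slices X
      = adjS 𝓙 ⋆ uline X ⋆ (𝓙 ⋆ adjS 𝓙 ⋆ uline X ⋆ 𝓙) := by
        simp only [slices, cmul_assoc]
    _ = adjS 𝓙 ⋆ uline X ⋆ adjS 𝓙₃ ⋆ uline (P d) ⋆ 𝓙₃ ⋆ uline X ⋆ 𝓙 := by
        rw [← adjS_cmul_uline_cmul_of_regular h.regular_braiding]
    _ = adjS 𝓙 ⋆ adjS 𝓙₃ ⋆ uline (P d)⁻¹ ⋆ uline X' ⋆ uline (P d) ⋆ uline X' ⋆ 𝓙₃ ⋆ 𝓙 := by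
        rw [← h.leg.uline_cmul_cmul, ← h.leg.adjS_cmul_cmul, adjS_cmul_uline_amplU_inv_cmul]
    _ = adjS 𝓙 ⋆ adjS 𝓙₃ ⋆ uline ((P d)⁻¹ * (X' * P d * X')) ⋆ 𝓙₃ ⋆ 𝓙 := by
        simp only [uline_mul, cmul_assoc]
    _ = adjS 𝓙 ⋆ adjS 𝓙₃ ⋆ uline X' ⋆ 𝓙₃ ⋆ 𝓙 := by
        rw [h.pentagon₁]
        simp only [uline_mul, cmul_assoc]
        rw [adjS_cmul_uline_amplU_inv_cmul, uline_amplU_cmul]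
    _ = slices X := by
        rw [h.leg.uline_cmul_cmul, adjS_creations₃_cmul_creations₃_cmul (isClosed_cmul _ _), slices]

/-- Regularity makes `A(X)` self-adjoint, since it gives `A(X)* = [A(X)* A(X)]`. -/
theorem adjS_slices_eq (h : IsRegularMU d X d' X') :
    adjS (slices X) = slices X := by
  have key : slices X⁻¹ ⋆ slices X = slices X⁻¹ := by
    calc slices X⁻¹ ⋆ slices X
        = adjS 𝓙 ⋆ uline X⁻¹ ⋆ (𝓙 ⋆ adjS 𝓙 ⋆ uline X ⋆ 𝓙) := by
          simp only [slices, cmul_assoc]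
      _ = adjS 𝓙 ⋆ uline X⁻¹ ⋆ adjS 𝓙₃ ⋆ uline (P (X * d⁻¹)) ⋆ 𝓙₃ ⋆ uline X ⋆ 𝓙 := by
          rw [← adjS_cmul_uline_cmul_of_regular h.regular]
      _ = adjS 𝓙 ⋆ adjS 𝓙₃ ⋆ uline (X'⁻¹ * P (X * d⁻¹) * X') ⋆ 𝓙₃ ⋆ 𝓙 := by
          rw [← h.leg.uline_cmul_cmul, ← h.leg.inv.adjS_cmul_cmul]
          simp only [uline_mul, cmul_assoc]
      _ = adjS 𝓙 ⋆ adjS 𝓙₃ ⋆ uline X'⁻¹ ⋆ 𝓙₃ ⋆ 𝓙 := by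
          rw [h.pentagon₂]
          simp only [uline_mul, cmul_assoc]
          rw [adjS_cmul_uline_amplU_cmul, uline_amplU_inv_cmul]
      _ = slices X⁻¹ := by
          rw [h.leg.inv.uline_cmul_cmul, adjS_creations₃_cmul_creations₃_cmul (isClosed_cmul _ _),
            slices]
  rw [← adjS_slices] at key
  have h2 := congrArg adjS key
  rw [adjS_cmul, adjS_adjS (isClosed_slices X)] at h2
  exact key.symm.trans h2

/-- The space `d⁻¹ (A(X) ⊗ id) d`. -/
def twisted (d X : unitary (HTensor H H →L[ℂ] HTensor H H)) :
    Submodule ℂ (HTensor H H →L[ℂ] HTensor H H) :=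
  uline d⁻¹ ⋆ amplS H (slices X) ⋆ uline d

/-- By naturality, conjugation by the braiding turns slices of `X` on the first leg into slices
over a new leg. -/
theorem twisted_eq (h : IsRegularMU d X d' X') :
    twisted d X = adjS 𝓙₃ ⋆ uline (P d * X' * (P d)⁻¹) ⋆ 𝓙₃ := by
  have h1 : d'⁻¹ * P X * d' = P d * X' * (P d)⁻¹ := by
    calc d'⁻¹ * P X * d' = d'⁻¹ * (P X * d' * P d) * (P d)⁻¹ := by group
      _ = _ := by rw [← h.naturality]; group
  rw [twisted, amplS_slices, ← h1, uline_mul, uline_mul, ← cmul_assoc, ← cmul_assoc,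
    ← h.leg_braiding.inv.adjS_cmul]
  simp only [cmul_assoc]
  rw [← h.leg_braiding.uline_cmul]

/-- With a rank one operator on the first leg, the conjugation by the braiding disappears. -/
theorem adjS_creations_cmul_twisted (h : IsRegularMU d X d' X') :
    adjS 𝓙 ⋆ twisted d X = slices X ⋆ adjS 𝓙 := by
  calc adjS 𝓙 ⋆ twisted d X
      = adjS 𝓙 ⋆ adjS 𝓙₃ ⋆ uline (P d) ⋆ uline X' ⋆ uline (P d⁻¹) ⋆ 𝓙₃ := by
        rw [h.twisted_eq, ← map_inv]; simp only [uline_mul, cmul_assoc]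
    _ = adjS 𝓙 ⋆ uline X ⋆ adjS 𝓙₃ ⋆ uline (P d⁻¹) ⋆ 𝓙₃ := by
        rw [adjS_cmul_uline_amplU_cmul, h.leg.adjS_cmul_cmul]
    _ = adjS 𝓙 ⋆ uline X ⋆ 𝓙 ⋆ adjS 𝓙 := by
        have := amplS_slices d⁻¹
        rw [h.regular_braiding_inv, compacts_eq, ← creations_cmul_adjS_creations] at this
        rw [this]
    _ = _ := by simp only [slices, cmul_assoc]

theorem twisted_cmul_creations (h : IsRegularMU d X d' X') :
    twisted d X ⋆ 𝓙 = 𝓙 ⋆ slices X := by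
  calc twisted d X ⋆ 𝓙
      = adjS 𝓙₃ ⋆ uline (P d) ⋆ uline X' ⋆ uline (P d)⁻¹ ⋆ 𝓙₃ ⋆ 𝓙 := by
        rw [h.twisted_eq]; simp only [uline_mul, cmul_assoc]
    _ = adjS 𝓙₃ ⋆ uline (P d) ⋆ 𝓙₃ ⋆ uline X ⋆ 𝓙 := by
        rw [uline_amplU_inv_cmul, h.leg.uline_cmul_cmul]
    _ = 𝓙 ⋆ slices X := by
        rw [adjS_cmul_uline_cmul_of_regular h.regular_braiding, slices]

/-- `X` is a multiplier of `K ⊗ A(X)`. -/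
theorem uline_cmul_creations_cmul_slices (h : IsRegularMU d X d' X') :
    uline X ⋆ 𝓙 ⋆ slices X = 𝓙 ⋆ slices X := by
  calc uline X ⋆ 𝓙 ⋆ slices X
      = uline X ⋆ adjS 𝓙₃ ⋆ uline (P d * X' * (P d)⁻¹) ⋆ 𝓙₃ ⋆ 𝓙 := by
        rw [← h.twisted_cmul_creations, h.twisted_eq]; simp only [cmul_assoc]
    _ = adjS 𝓙₃ ⋆ uline (X' * (P d * X' * (P d)⁻¹)) ⋆ 𝓙₃ ⋆ 𝓙 := by
        rw [← h.leg.adjS_cmul_cmul, uline_mul X']; simp only [cmul_assoc]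
    _ = adjS 𝓙₃ ⋆ uline (P (d * X⁻¹)) ⋆ 𝓙₃ ⋆ uline X ⋆ 𝓙 := by
        rw [h.pentagon₃, uline_mul, uline_mul]
        simp only [cmul_assoc]
        rw [uline_amplU_cmul, h.leg.uline_cmul_cmul]
    _ = 𝓙 ⋆ slices X := by
        rw [adjS_cmul_uline_cmul_of_regular h.regular_inv, slices]

theorem uline_inv_cmul_creations_cmul_slices (h : IsRegularMU d X d' X') :
    uline X⁻¹ ⋆ 𝓙 ⋆ slices X = 𝓙 ⋆ slices X := by
  conv_lhs => rw [← h.uline_cmul_creations_cmul_slices]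
  exact uline_inv_cmul_uline_cmul X (isClosed_cmul _ _)

theorem adjS_twisted (h : IsRegularMU d X d' X') :
    adjS (twisted d X) = twisted d X := by
  rw [twisted, adjS_cmul, adjS_cmul, adjS_uline, adjS_uline, inv_inv, adjS_amplS,
    h.adjS_slices_eq, cmul_assoc]

theorem twisted_cmul_uline_inv_cmul_creations (h : IsRegularMU d X d' X') :
    twisted d X ⋆ uline X⁻¹ ⋆ 𝓙 = 𝓙 ⋆ slices X := by
  have h1 : twisted d X = adjS 𝓙₃ ⋆ uline (P d * X'⁻¹ * (P d)⁻¹) ⋆ 𝓙₃ := by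
    have h2 : (P d * X' * (P d)⁻¹)⁻¹ = P d * X'⁻¹ * (P d)⁻¹ := by group
    have h3 : adjS (adjS 𝓙₃) = 𝓙₃ := adjS_adjS (isClosed_creations₃ H)
    rw [← h.adjS_twisted, h.twisted_eq, adjS_cmul, adjS_cmul, adjS_uline, h2, h3, cmul_assoc]
  calc twisted d X ⋆ uline X⁻¹ ⋆ 𝓙
      = adjS 𝓙₃ ⋆ uline (P d * X'⁻¹ * (P d)⁻¹ * X'⁻¹) ⋆ 𝓙₃ ⋆ 𝓙 := by
        rw [h1, uline_mul (P d * X'⁻¹ * (P d)⁻¹)]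
        simp only [cmul_assoc]
        rw [h.leg.inv.uline_cmul_cmul]
    _ = adjS 𝓙₃ ⋆ uline (P (d * X⁻¹)) ⋆ 𝓙₃ ⋆ uline X⁻¹ ⋆ 𝓙 := by
        rw [h.pentagon₄, uline_mul, uline_mul]
        simp only [cmul_assoc]
        rw [uline_amplU_cmul, h.leg.inv.uline_cmul_cmul]
    _ = 𝓙 ⋆ slices X := by
        rw [adjS_cmul_uline_cmul_of_regular h.regular_inv, ← h.adjS_slices_eq, adjS_slices, slices]

end IsRegularMU

end MultiplicativeUnitaries

/-! ### The dual multiplicative unitary and the braided tensor product -/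

section BraidGroup

variable {Γ : Type*} [Group Γ] {a b f g : Γ}

/-- With `a`, `b` the two legs of a braiding and `f`, `g` those of `F`, the dual `a f⁻¹ a⁻¹` is
natural for the inverse braiding. -/
theorem dual_naturality (hb : a * b * a = b * a * b) (h1 : a * b * f = g * a * b) :
    b⁻¹ * a⁻¹ * (b * g⁻¹ * b⁻¹) = a * f⁻¹ * a⁻¹ * b⁻¹ * a⁻¹ := by
  have e1 : g⁻¹ = a * b * f⁻¹ * b⁻¹ * a⁻¹ := by
    have : g = a * b * f * b⁻¹ * a⁻¹ := by rw [h1]; group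
    rw [this]; group
  calc b⁻¹ * a⁻¹ * (b * g⁻¹ * b⁻¹)
      = b⁻¹ * a⁻¹ * (b * a * b) * f⁻¹ * (b⁻¹ * a⁻¹ * b⁻¹) := by rw [e1]; group
    _ = b⁻¹ * a⁻¹ * (b * a * b) * f⁻¹ * (b * a * b)⁻¹ := by group
    _ = a * f⁻¹ * a⁻¹ * b⁻¹ * a⁻¹ := by rw [← hb]; group

/-- The dual of a solution of the pentagon equation solves the pentagon equation for the inverse
braiding. -/
theorem dual_pentagon (hb : a * b * a = b * a * b) (h1 : a * b * f = g * a * b)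
    (h2 : b * a * g = f * b * a) (hp : g * f = f * a⁻¹ * g * a * g) :
    (b * g⁻¹ * b⁻¹) * (a * f⁻¹ * a⁻¹) =
      (a * f⁻¹ * a⁻¹) * a * (b * g⁻¹ * b⁻¹) * a⁻¹ * (b * g⁻¹ * b⁻¹) := by
  have e1 : b⁻¹ * a = a * b * a⁻¹ * b⁻¹ := by
    calc b⁻¹ * a = b⁻¹ * (a * b * a) * a⁻¹ * b⁻¹ := by group
      _ = _ := by rw [hb]; group
  have e2 : b⁻¹ * a⁻¹ * b = a * b⁻¹ * a⁻¹ := by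
    calc b⁻¹ * a⁻¹ * b = (b⁻¹ * (a * b * a) * a⁻¹)⁻¹ := by group
      _ = _ := by rw [hb]; group
  have e3 : g⁻¹ * (a * b) = a * b * f⁻¹ := by
    calc g⁻¹ * (a * b) = g⁻¹ * (g * a * b) * f⁻¹ := by rw [← h1]; group
      _ = _ := by group
  have e4 : a⁻¹ * b⁻¹ * f⁻¹ = g⁻¹ * a⁻¹ * b⁻¹ := by
    calc a⁻¹ * b⁻¹ * f⁻¹ = (f * b * a)⁻¹ := by group
      _ = _ := by rw [← h2]; group
  have e5 : b⁻¹ * a⁻¹ * g⁻¹ = f⁻¹ * b⁻¹ * a⁻¹ := by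
    calc b⁻¹ * a⁻¹ * g⁻¹ = (g * a * b)⁻¹ := by group
      _ = _ := by rw [← h1]; group
  have e6 : f⁻¹ * b = b * a * g⁻¹ * a⁻¹ := by
    calc f⁻¹ * b = f⁻¹ * (f * b * a) * g⁻¹ * a⁻¹ := by rw [← h2]; group
      _ = _ := by group
  have e7 : f⁻¹ * g⁻¹ = g⁻¹ * a⁻¹ * g⁻¹ * a * f⁻¹ := by
    calc f⁻¹ * g⁻¹ = (g * f)⁻¹ := by group
      _ = _ := by rw [hp]; group
  calc (b * g⁻¹ * b⁻¹) * (a * f⁻¹ * a⁻¹)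
      = b * g⁻¹ * (b⁻¹ * a) * f⁻¹ * a⁻¹ := by group
    _ = b * (g⁻¹ * (a * b)) * (a⁻¹ * b⁻¹ * f⁻¹) * a⁻¹ := by rw [e1]; group
    _ = b * a * b * (f⁻¹ * g⁻¹) * (a⁻¹ * b⁻¹ * a⁻¹) := by rw [e3, e4]; group
    _ = (b * a * b) * (g⁻¹ * a⁻¹ * g⁻¹ * a * f⁻¹) * (a * b * a)⁻¹ := by rw [e7]; group
    _ = (a * b * a) * (g⁻¹ * a⁻¹ * g⁻¹ * a * f⁻¹) * (b * a * b)⁻¹ := by rw [hb]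
    _ = a * (b * a * g⁻¹ * a⁻¹) * g⁻¹ * a * (f⁻¹ * b⁻¹ * a⁻¹) * b⁻¹ := by group
    _ = a * f⁻¹ * b * g⁻¹ * (a * b⁻¹ * a⁻¹) * g⁻¹ * b⁻¹ := by rw [← e6, ← e5]; group
    _ = _ := by rw [← e2]; group

end BraidGroup

section BraidedProduct

variable {H : Type*} [NormedAddCommGroup H] [InnerProductSpace ℂ H] [CompleteSpace H]

local notation "𝓙" => creations H H
local notation "𝓙₃" => creations₃ H
local notation "P" => amplU (HTensor H H) H

/-- A regular multiplicative unitary `F` with respect to a braiding `c`, where `c` satisfies the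
braid relation and is natural for `F` in both legs. -/
structure IsBraidedMU (c F : unitary (HTensor H H →L[ℂ] HTensor H H))
    (c' F' : unitary (HTensor (HTensor H H) H →L[ℂ] HTensor (HTensor H H) H)) : Prop
    extends IsRegularMU c F c' F' where
  braid : P c * c' * P c = c' * P c * c'
  naturality_left : P c * c' * P F = F' * P c * c'

namespace IsBraidedMU

variable {c F : unitary (HTensor H H →L[ℂ] HTensor H H)}
  {c' F' : unitary (HTensor (HTensor H H) H →L[ℂ] HTensor (HTensor H H) H)}

/-- The dual of `F` is a regular multiplicative unitary for the inverse braiding. -/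
theorem dual (h : IsBraidedMU c F c' F') :
    IsRegularMU c⁻¹ (c * F⁻¹ * c⁻¹) c'⁻¹ (c' * F'⁻¹ * c'⁻¹) where
  leg_braiding := h.leg_braiding.inv
  leg := (h.leg_braiding.mul h.leg.inv).mul h.leg_braiding.inv
  naturality := by
    simpa only [map_mul, map_inv] using dual_naturality h.braid h.naturality_left
  pentagon := by
    simpa only [map_mul, map_inv, inv_inv] using
      dual_pentagon h.braid h.naturality_left h.naturality h.pentagon
  regular_braiding := h.regular_braiding_inv
  regular := by
    have : c * F⁻¹ * c⁻¹ * c⁻¹⁻¹ = c * F⁻¹ := by group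
    rw [this, h.regular_inv]

end IsBraidedMU

open IsRegularMU

/-- The space `A ⊠ id`, for `A = A(c F* c⁻¹)`. -/
def leftFactor (c F : unitary (HTensor H H →L[ℂ] HTensor H H)) :
    Submodule ℂ (HTensor H H →L[ℂ] HTensor H H) :=
  amplS H (slices (c * F⁻¹ * c⁻¹))

/-- The space `id ⊠ B`, for `B = A(F)`. -/
def rightFactor (c F : unitary (HTensor H H →L[ℂ] HTensor H H)) :
    Submodule ℂ (HTensor H H →L[ℂ] HTensor H H) :=
  twisted c F

/-- The braided tensor product `A ⊠ B`, for `A = A(c F* c⁻¹)` and `B = A(F)`. -/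
def braidedProduct (c F : unitary (HTensor H H →L[ℂ] HTensor H H)) :
    Submodule ℂ (HTensor H H →L[ℂ] HTensor H H) :=
  leftFactor c F ⋆ rightFactor c F

namespace IsBraidedMU

variable {c F : unitary (HTensor H H →L[ℂ] HTensor H H)}
  {c' F' : unitary (HTensor (HTensor H H) H →L[ℂ] HTensor (HTensor H H) H)}

local notation "𝓐" => leftFactor c F
local notation "𝓑" => rightFactor c F
-- `F₂₃` moved past the first leg by the braiding; its slices over the first leg span `id ⊠ B`
local notation "𝓦" => P c * F' * (P c)⁻¹
local notation "𝓖" => P (c * F⁻¹ * c⁻¹)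
-- `c₁₂ (A ⊗ id ⊗ id) c₁₂⁻¹`
local notation "𝓐'" => amplS H (twisted c⁻¹ (c * F⁻¹ * c⁻¹))

theorem leftFactor_cmul_self (h : IsBraidedMU c F c' F') : 𝓐 ⋆ 𝓐 = 𝓐 := by
  rw [leftFactor, ← amplS_cmul, h.dual.slices_cmul_slices]

theorem adjS_leftFactor (h : IsBraidedMU c F c' F') : adjS 𝓐 = 𝓐 := by
  rw [leftFactor, adjS_amplS, h.dual.adjS_slices_eq]

theorem rightFactor_cmul_self (h : IsBraidedMU c F c' F') : 𝓑 ⋆ 𝓑 = 𝓑 := by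
  rw [rightFactor, twisted]
  simp only [cmul_assoc]
  rw [uline_cmul_uline_inv_cmul c (isClosed_cmul _ _), cmul_congr_left (amplS_cmul _ _).symm,
    h.slices_cmul_slices]

theorem adjS_rightFactor (h : IsBraidedMU c F c' F') : adjS 𝓑 = 𝓑 :=
  h.adjS_twisted

theorem rightFactor_eq (h : IsBraidedMU c F c' F') : 𝓑 = adjS 𝓙₃ ⋆ uline 𝓦 ⋆ 𝓙₃ :=
  h.twisted_eq

theorem leftFactor_cmul_adjS (h : IsBraidedMU c F c' F') :
    𝓐 ⋆ adjS 𝓙₃ = adjS 𝓙₃ ⋆ 𝓐' := by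
  have h1 : amplS H (adjS 𝓙) = adjS 𝓙₃ := (adjS_amplS _).symm
  rw [leftFactor, ← h1, ← amplS_cmul, ← amplS_cmul, h.dual.adjS_creations_cmul_twisted]

theorem twisted_cmul_creations₃ (h : IsBraidedMU c F c' F') : 𝓐' ⋆ 𝓙₃ = 𝓙₃ ⋆ 𝓐 := by
  rw [leftFactor, creations₃, ← amplS_cmul, ← amplS_cmul, h.dual.twisted_cmul_creations]

/-- `c₁₂ (A ⊗ id ⊗ id) c₁₂⁻¹` commutes with `c₁₂ F₂₃ c₁₂⁻¹`. -/
theorem twisted_cmul_uline (h : IsBraidedMU c F c' F') : 𝓐' ⋆ uline 𝓦 = uline 𝓦 ⋆ 𝓐' := by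
  have h1 : 𝓐' = uline (P c) ⋆ amplS H 𝓐 ⋆ uline (P c)⁻¹ := by
    rw [twisted, amplS_cmul, amplS_cmul, amplS_uline, amplS_uline, inv_inv, map_inv, leftFactor]
  calc 𝓐' ⋆ uline 𝓦
      = uline (P c) ⋆ (amplS H 𝓐 ⋆ uline F') ⋆ uline (P c)⁻¹ := by
        rw [h1, uline_mul, uline_mul]
        simp only [cmul_assoc]
        rw [uline_inv_cmul_uline_cmul _ (isClosed_cmul _ _)]
    _ = uline 𝓦 ⋆ 𝓐' := by
        rw [leftFactor, ← h.leg.uline_cmul_amplS, h1, uline_mul, uline_mul, leftFactor]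
        simp only [cmul_assoc]
        rw [uline_inv_cmul_uline_cmul _ (isClosed_cmul _ _)]

/-- The two factors of the braided tensor product commute as spaces. -/
theorem leftFactor_cmul_rightFactor (h : IsBraidedMU c F c' F') : 𝓐 ⋆ 𝓑 = 𝓑 ⋆ 𝓐 := by
  rw [h.rightFactor_eq, cmul_congr_left h.leftFactor_cmul_adjS]
  simp only [cmul_assoc]
  rw [cmul_congr_left h.twisted_cmul_uline]
  simp only [cmul_assoc]
  rw [h.twisted_cmul_creations₃]

theorem leftFactor_cmul_rightFactor_cmul_leftFactor (h : IsBraidedMU c F c' F') :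
    𝓐 ⋆ 𝓑 ⋆ 𝓐 = braidedProduct c F := by
  rw [← h.leftFactor_cmul_rightFactor, cmul_congr_left h.leftFactor_cmul_self, braidedProduct]

theorem rightFactor_cmul_leftFactor_cmul_rightFactor
    (h : IsBraidedMU c F c' F') : 𝓑 ⋆ 𝓐 ⋆ 𝓑 = braidedProduct c F := by
  rw [h.leftFactor_cmul_rightFactor, cmul_congr_left h.rightFactor_cmul_self, braidedProduct,
    h.leftFactor_cmul_rightFactor]

theorem braidedProduct_cmul_self (h : IsBraidedMU c F c' F') :
    braidedProduct c F ⋆ braidedProduct c F = braidedProduct c F := by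
  conv_lhs => rw [braidedProduct, cmul_assoc, ← cmul_assoc 𝓑, ← h.leftFactor_cmul_rightFactor,
    cmul_assoc, h.rightFactor_cmul_self, cmul_congr_left h.leftFactor_cmul_self]
  rfl

theorem adjS_braidedProduct (h : IsBraidedMU c F c' F') :
    adjS (braidedProduct c F) = braidedProduct c F := by
  rw [braidedProduct, adjS_cmul, h.adjS_leftFactor, h.adjS_rightFactor,
    h.leftFactor_cmul_rightFactor]

/-- The pentagon equation, read as a conjugation of `𝓦` by the dual of `F`. -/
theorem mul_conj (h : IsBraidedMU c F c' F') : F' * 𝓦 = 𝓖 * 𝓦 * 𝓖⁻¹ := by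
  have e := h.pentagon₁
  calc F' * 𝓦 = P c * ((P c)⁻¹ * (F' * P c * F')) * (P c)⁻¹ := by group
    _ = _ := by rw [e]; simp only [map_mul, map_inv]; group

/-- `F` is also a multiplier of `K ⊗ B` after the braiding has been applied. -/
theorem uline_cmul_creations₃_cmul_rightFactor (h : IsBraidedMU c F c' F') :
    uline 𝓦 ⋆ 𝓙₃ ⋆ 𝓑 = 𝓙₃ ⋆ 𝓑 := by
  have e1 : 𝓦 = c'⁻¹ * P F * c' := by
    calc 𝓦 = c'⁻¹ * (c' * P c * F') * (P c)⁻¹ := by group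
      _ = _ := by rw [h.naturality]; group
  have e2 : uline (P F) ⋆ 𝓙₃ ⋆ amplS H (slices F) = 𝓙₃ ⋆ amplS H (slices F) := by
    rw [creations₃, ← amplS_uline, ← amplS_cmul, ← amplS_cmul,
      h.uline_cmul_creations_cmul_slices]
  calc uline 𝓦 ⋆ 𝓙₃ ⋆ 𝓑
      = uline c'⁻¹ ⋆ uline (P F) ⋆ 𝓙₃ ⋆ uline c ⋆ uline c⁻¹ ⋆ amplS H (slices F) ⋆ uline c := by
        rw [e1, uline_mul, uline_mul, rightFactor, twisted]
        simp only [cmul_assoc]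
        rw [h.leg_braiding.uline_cmul_cmul]
    _ = uline c'⁻¹ ⋆ (uline (P F) ⋆ 𝓙₃ ⋆ amplS H (slices F)) ⋆ uline c := by
        rw [uline_cmul_uline_inv_cmul c (isClosed_cmul _ _)]
        simp only [cmul_assoc]
    _ = 𝓙₃ ⋆ 𝓑 := by
        rw [e2, cmul_assoc, h.leg_braiding.inv.uline_cmul_cmul, rightFactor, twisted]

theorem uline_inv_cmul_creations₃_cmul_rightFactor (h : IsBraidedMU c F c' F') :
    uline (𝓦)⁻¹ ⋆ 𝓙₃ ⋆ 𝓑 = 𝓙₃ ⋆ 𝓑 := by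
  conv_lhs => rw [← h.uline_cmul_creations₃_cmul_rightFactor]
  exact uline_inv_cmul_uline_cmul _ (isClosed_cmul _ _)

theorem uline_dual_inv_cmul (h : IsBraidedMU c F c' F') : uline (𝓖)⁻¹ ⋆ 𝓙₃ ⋆ 𝓐 = 𝓙₃ ⋆ 𝓐 := by
  rw [← map_inv, leftFactor, creations₃, ← amplS_uline, ← amplS_cmul, ← amplS_cmul,
    h.dual.uline_inv_cmul_creations_cmul_slices]

theorem leftFactor_eq : 𝓐 = adjS 𝓙₃ ⋆ uline 𝓖 ⋆ 𝓙₃ := amplS_slices _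

/-- Multiplication by `F` preserves the braided tensor product. -/
theorem uline_cmul_braidedProduct (h : IsBraidedMU c F c' F') :
    uline F ⋆ braidedProduct c F = braidedProduct c F := by
  have e1 : ∀ Q : Submodule ℂ (HTensor H H →L[ℂ] HTensor H H),
      𝓑 ⋆ Q = adjS 𝓙₃ ⋆ uline 𝓦 ⋆ 𝓙₃ ⋆ Q := fun Q => by
    rw [h.rightFactor_eq, cmul_assoc, cmul_assoc]
  calc uline F ⋆ braidedProduct c F
      = uline F ⋆ adjS 𝓙₃ ⋆ uline 𝓦 ⋆ 𝓙₃ ⋆ 𝓐 ⋆ 𝓑 := by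
        rw [← h.rightFactor_cmul_leftFactor_cmul_rightFactor]
        exact congrArg (uline F ⋆ ·) (e1 _)
    _ = adjS 𝓙₃ ⋆ uline (F' * 𝓦) ⋆ 𝓙₃ ⋆ 𝓐 ⋆ 𝓑 := by
        rw [← h.leg.adjS_cmul_cmul, uline_mul F']
        simp only [cmul_assoc]
    _ = adjS 𝓙₃ ⋆ uline 𝓖 ⋆ uline 𝓦 ⋆ (uline (𝓖)⁻¹ ⋆ 𝓙₃ ⋆ 𝓐) ⋆ 𝓑 := by
        rw [h.mul_conj, uline_mul (𝓖 * 𝓦), uline_mul 𝓖]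
        simp only [cmul_assoc]
    _ = adjS 𝓙₃ ⋆ uline 𝓖 ⋆ (uline 𝓦 ⋆ 𝓙₃ ⋆ 𝓑) ⋆ 𝓐 := by
        rw [h.uline_dual_inv_cmul, cmul_assoc, h.leftFactor_cmul_rightFactor]
        simp only [cmul_assoc]
    _ = 𝓐 ⋆ 𝓑 ⋆ 𝓐 := by
        rw [h.uline_cmul_creations₃_cmul_rightFactor, leftFactor_eq]
        simp only [cmul_assoc]
    _ = braidedProduct c F := h.leftFactor_cmul_rightFactor_cmul_leftFactor

theorem uline_inv_cmul_braidedProduct (h : IsBraidedMU c F c' F') :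
    uline F⁻¹ ⋆ braidedProduct c F = braidedProduct c F := by
  conv_lhs => rw [← h.uline_cmul_braidedProduct]
  exact uline_inv_cmul_uline_cmul F (isClosed_cmul _ _)

theorem braidedProduct_cmul_uline (h : IsBraidedMU c F c' F') :
    braidedProduct c F ⋆ uline F = braidedProduct c F := by
  have := congrArg adjS h.uline_inv_cmul_braidedProduct
  rwa [adjS_cmul, adjS_uline, inv_inv, h.adjS_braidedProduct] at this

theorem leftFactor_cmul_uline_cmul_rightFactor (h : IsBraidedMU c F c' F') :
    𝓐 ⋆ uline F ⋆ 𝓑 = braidedProduct c F := by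
  have e1 : (𝓖)⁻¹ * F' = 𝓦 * (𝓖)⁻¹ * (𝓦)⁻¹ := by
    calc (𝓖)⁻¹ * F' = (𝓖)⁻¹ * (F' * 𝓦) * (𝓦)⁻¹ := by group
      _ = _ := by rw [h.mul_conj]; group
  have e2 : ∀ Q : Submodule ℂ (HTensor H H →L[ℂ] HTensor H H),
      𝓐 ⋆ Q = adjS 𝓙₃ ⋆ uline (𝓖)⁻¹ ⋆ 𝓙₃ ⋆ Q := fun Q => by
    have h3 : adjS (adjS 𝓙₃) = 𝓙₃ := adjS_adjS (isClosed_creations₃ H)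
    have := congrArg adjS (leftFactor_eq (c := c) (F := F))
    rw [h.adjS_leftFactor, adjS_cmul, adjS_cmul, adjS_uline, h3, cmul_assoc] at this
    rw [this, cmul_assoc, cmul_assoc]
  have e3 : 𝓐' ⋆ uline (𝓖)⁻¹ ⋆ 𝓙₃ = 𝓙₃ ⋆ 𝓐 := by
    rw [← map_inv, leftFactor, creations₃, ← amplS_uline, ← amplS_cmul, ← amplS_cmul,
      ← amplS_cmul, h.dual.twisted_cmul_uline_inv_cmul_creations]
  calc 𝓐 ⋆ uline F ⋆ 𝓑
      = 𝓐 ⋆ 𝓐 ⋆ uline F ⋆ 𝓑 := by rw [cmul_congr_left h.leftFactor_cmul_self]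
    _ = 𝓐 ⋆ adjS 𝓙₃ ⋆ uline ((𝓖)⁻¹ * F') ⋆ 𝓙₃ ⋆ 𝓑 := by
        rw [uline_mul, cmul_assoc, h.leg.uline_cmul_cmul]
        exact congrArg (𝓐 ⋆ ·) (e2 _)
    _ = 𝓐 ⋆ adjS 𝓙₃ ⋆ uline 𝓦 ⋆ uline (𝓖)⁻¹ ⋆ uline (𝓦)⁻¹ ⋆ 𝓙₃ ⋆ 𝓑 := by
        rw [e1, uline_mul (𝓦 * (𝓖)⁻¹), uline_mul 𝓦]
        simp only [cmul_assoc]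
    _ = adjS 𝓙₃ ⋆ (𝓐' ⋆ uline 𝓦) ⋆ uline (𝓖)⁻¹ ⋆ 𝓙₃ ⋆ 𝓑 := by
        rw [h.uline_inv_cmul_creations₃_cmul_rightFactor, cmul_congr_left h.leftFactor_cmul_adjS]
        simp only [cmul_assoc]
    _ = adjS 𝓙₃ ⋆ uline 𝓦 ⋆ (𝓐' ⋆ uline (𝓖)⁻¹ ⋆ 𝓙₃) ⋆ 𝓑 := by
        rw [h.twisted_cmul_uline]
        simp only [cmul_assoc]
    _ = 𝓑 ⋆ 𝓐 ⋆ 𝓑 := by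
        rw [e3, h.rightFactor_eq]
        simp only [cmul_assoc]
    _ = braidedProduct c F := h.rightFactor_cmul_leftFactor_cmul_rightFactor

end IsBraidedMU

end BraidedProduct

/-! ### Operators underlying morphisms of a braided concrete category -/

section Nondegenerate

variable {E G : Type*} [NormedAddCommGroup E] [InnerProductSpace ℂ E] [CompleteSpace E]
  [NormedAddCommGroup G] [InnerProductSpace ℂ G]

theorem actsNondegenerately_iff (S : Submodule ℂ (E →L[ℂ] E)) :
    ActsNondegenerately S ↔ ∀ z : E, (∀ s ∈ S, ∀ x, ⟪s x, z⟫_ℂ = 0) → z = 0 := by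
  rw [ActsNondegenerately, Submodule.topologicalClosure_eq_top_iff, Submodule.eq_bot_iff]
  refine forall_congr' fun z => imp_congr_left ?_
  rw [Submodule.mem_orthogonal]
  constructor
  · exact fun h s hs x => h _ (Submodule.subset_span ⟨s, hs, x, rfl⟩)
  · intro h u hu
    induction hu using Submodule.span_induction with
    | mem u hu =>
      obtain ⟨s, hs, x, rfl⟩ := hu
      exact h s hs x
    | zero => exact inner_zero_left _
    | add u v _ _ hu hv => rw [inner_add_left, hu, hv, add_zero]
    | smul a u _ hu => rw [inner_smul_left, hu, mul_zero]

theorem ActsNondegenerately.cmul {S T : Submodule ℂ (E →L[ℂ] E)} (hS : ActsNondegenerately S)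
    (hT : ActsNondegenerately T) : ActsNondegenerately (S ⋆ T) := by
  rw [actsNondegenerately_iff] at *
  intro z hz
  refine hS z fun s hs x => ?_
  have : adjoint s z = 0 := hT _ fun t ht y => by
    rw [ContinuousLinearMap.adjoint_inner_right]
    exact hz _ (comp_mem_cmul hs ht) y
  rw [← ContinuousLinearMap.adjoint_inner_right, this, inner_zero_right]

theorem actsNondegenerately_uline (u : unitary (E →L[ℂ] E)) : ActsNondegenerately (uline u) := by
  rw [actsNondegenerately_iff]
  intro z hz
  have h1 : u.1 ((u⁻¹ : unitary (E →L[ℂ] E)).1 z) = z :=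
    DFunLike.congr_fun (congrArg Subtype.val (mul_inv_cancel u)) z
  have h2 := hz u.1 (by rw [uline, line]; exact subset_closedSpan _ rfl) ((u⁻¹ : unitary (E →L[ℂ] E)).1 z)
  rw [h1] at h2
  exact inner_self_eq_zero.1 h2

theorem ActsNondegenerately.amplS {S : Submodule ℂ (E →L[ℂ] E)} (hS : ActsNondegenerately S) :
    ActsNondegenerately (amplS G S) := by
  rw [actsNondegenerately_iff] at *
  intro z hz
  refine eq_zero_of_inner_tmul fun x y => ?_
  have : adjoint ((tmul E G).flip y) z = 0 := hS _ fun s hs t => by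
    rw [ContinuousLinearMap.adjoint_inner_right, ContinuousLinearMap.flip_apply, ← ampl_tmul]
    exact hz _ (by rw [_root_.amplS]; exact subset_closedSpan _ ⟨s, hs, rfl⟩) _
  rw [← ContinuousLinearMap.flip_apply, ← ContinuousLinearMap.adjoint_inner_right, this,
    inner_zero_right]

theorem actsNondegenerately_slices (X : unitary (HTensor E E →L[ℂ] HTensor E E)) :
    ActsNondegenerately (slices X) := by
  rw [actsNondegenerately_iff]
  intro z hz
  have h1 : ∀ x, tmul E E x z = 0 := fun x => by
    have : adjoint X.1 (tmul E E x z) = 0 := eq_zero_of_inner_tmul fun y t => by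
      rw [ContinuousLinearMap.adjoint_inner_right,
        ← ContinuousLinearMap.adjoint_inner_left (tmul E E x)]
      refine hz ((adjoint (tmul E E x)).comp (X.1.comp (tmul E E y))) ?_ t
      have hc : ∀ y, tmul E E y ∈ creations E E := fun y => by
        rw [creations]; exact subset_closedSpan _ ⟨y, rfl⟩
      exact comp_mem_cmul (adjoint_mem_adjS (hc x))
        (comp_mem_cmul (by rw [uline, line]; exact subset_closedSpan _ rfl) (hc y))
    have h2 : X.1 (adjoint X.1 (tmul E E x z)) = tmul E E x z :=
      DFunLike.congr_fun (Unitary.mul_star_self_of_mem X.2) _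
    rw [← h2, this, map_zero]
  have h3 := inner_tmul_tmul z z z z
  rw [h1, inner_zero_left] at h3
  exact inner_self_eq_zero.1 (mul_self_eq_zero.1 h3.symm)

end Nondegenerate

section BraidingLegs

variable {C : Type u} [Category.{v} C] [MonoidalCategory C] [BraidedCategory C] {L : C}

theorem leg₂₃_braiding_naturality (f : L ⊗ L ⟶ L ⊗ L) :
    leg₂₃ f ≫ leg₁₂ (β_ L L).hom ≫ leg₂₃ (β_ L L).hom =
      leg₁₂ (β_ L L).hom ≫ leg₂₃ (β_ L L).hom ≫ leg₁₂ f := by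
  have h : leg₁₂ (β_ L L).hom ≫ leg₂₃ (β_ L L).hom = (α_ L L L).hom ≫ (β_ L (L ⊗ L)).hom := by
    rw [leg₁₂, leg₂₃, BraidedCategory.braiding_tensor_right_hom]
    simp
  rw [h, ← Category.assoc (leg₁₂ _), h, leg₂₃, leg₁₂]
  simp only [Category.assoc, Iso.inv_hom_id_assoc, BraidedCategory.braiding_naturality_right]

theorem leg₁₂_braiding_naturality (f : L ⊗ L ⟶ L ⊗ L) :
    leg₁₂ f ≫ leg₂₃ (β_ L L).hom ≫ leg₁₂ (β_ L L).hom =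
      leg₂₃ (β_ L L).hom ≫ leg₁₂ (β_ L L).hom ≫ leg₂₃ f := by
  have h : leg₂₃ (β_ L L).hom ≫ leg₁₂ (β_ L L).hom = (β_ (L ⊗ L) L).hom ≫ (α_ L L L).inv := by
    rw [leg₁₂, leg₂₃, BraidedCategory.braiding_tensor_left_hom]
    simp
  rw [h, ← Category.assoc (leg₂₃ _), h, leg₂₃, leg₁₂]
  simp only [Category.assoc, Iso.inv_hom_id_assoc, BraidedCategory.braiding_naturality_left_assoc]

end BraidingLegs

section Realisation

/-- Conjugation of operators on `F` by a unitary `u : E → F`. -/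
def conjOp {E F : Type*} [NormedAddCommGroup E] [InnerProductSpace ℂ E] [CompleteSpace E]
    [NormedAddCommGroup F] [InnerProductSpace ℂ F] [CompleteSpace F]
    (u : E →L[ℂ] F) (T : F →L[ℂ] F) : E →L[ℂ] E :=
  (adjoint u).comp (T.comp u)

section conjOp

variable {E F : Type*} [NormedAddCommGroup E] [InnerProductSpace ℂ E] [CompleteSpace E]
    [NormedAddCommGroup F] [InnerProductSpace ℂ F] [CompleteSpace F]

theorem conjOp_comp {u : E →L[ℂ] F} (hu : u.comp (adjoint u) = ContinuousLinearMap.id ℂ F)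
    (S T : F →L[ℂ] F) : conjOp u (S.comp T) = (conjOp u S).comp (conjOp u T) := by
  calc conjOp u (S.comp T)
      = (adjoint u).comp ((S.comp ((ContinuousLinearMap.id ℂ F).comp T)).comp u) := by
        rw [ContinuousLinearMap.id_comp, conjOp]
    _ = _ := by rw [← hu]; simp only [conjOp, ContinuousLinearMap.comp_assoc]

theorem conjOp_id {u : E →L[ℂ] F} (hu : (adjoint u).comp u = ContinuousLinearMap.id ℂ E) :
    conjOp u (ContinuousLinearMap.id ℂ F) = ContinuousLinearMap.id ℂ E := by
  rw [conjOp, ContinuousLinearMap.id_comp, hu]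

theorem adjoint_conjOp (u : E →L[ℂ] F) (T : F →L[ℂ] F) :
    adjoint (conjOp u T) = conjOp u (adjoint T) := by
  rw [conjOp, ContinuousLinearMap.adjoint_comp, ContinuousLinearMap.adjoint_comp,
    ContinuousLinearMap.adjoint_adjoint, ContinuousLinearMap.comp_assoc, conjOp]

theorem comp_conjOp {u : E →L[ℂ] F} (hu : u.comp (adjoint u) = ContinuousLinearMap.id ℂ F)
    (T : F →L[ℂ] F) : u.comp (conjOp u T) = T.comp u := by
  rw [conjOp, ← ContinuousLinearMap.comp_assoc, hu, ContinuousLinearMap.id_comp]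

theorem eq_inv_of_comp_eq_id {u : unitary (E →L[ℂ] E)} {T : E →L[ℂ] E}
    (h : T.comp u.1 = ContinuousLinearMap.id ℂ E) : T = (u⁻¹).1 := by
  have h1 : u.1.comp (u⁻¹).1 = ContinuousLinearMap.id ℂ E :=
    congrArg Subtype.val (mul_inv_cancel u)
  rw [← ContinuousLinearMap.comp_id T, ← h1, ← ContinuousLinearMap.comp_assoc, h,
    ContinuousLinearMap.id_comp]

end conjOp

variable {C : Type u} [Category.{v} C] [MonoidalCategory C] [WStarCategory C]

namespace FibreFunctor

variable (Φ : FibreFunctor.{u, v, w} C)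

/-- The coherence isomorphism `For(X) ⊗ For(Y) → For(X ⊗ Y)` as a bounded operator. -/
def muL (X Y : C) : HTensor (Φ.obj X) (Φ.obj Y) →L[ℂ] Φ.obj (X ⊗ Y) :=
  ((Φ.μ X Y).toContinuousLinearEquiv : HilbertTensor (Φ.obj X) (Φ.obj Y) →L[ℂ] Φ.obj (X ⊗ Y))

theorem adjoint_muL (X Y : C) : adjoint (Φ.muL X Y) =
    ((Φ.μ X Y).symm.toContinuousLinearEquiv :
      Φ.obj (X ⊗ Y) →L[ℂ] HilbertTensor (Φ.obj X) (Φ.obj Y)) :=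
  LinearIsometryEquiv.adjoint_eq_symm (Φ.μ X Y)

theorem muL_comp_adjoint (X Y : C) :
    (Φ.muL X Y).comp (adjoint (Φ.muL X Y)) = ContinuousLinearMap.id ℂ _ := by
  rw [adjoint_muL]
  exact ContinuousLinearMap.ext fun z => (Φ.μ X Y).apply_symm_apply z

theorem adjoint_comp_muL (X Y : C) :
    (adjoint (Φ.muL X Y)).comp (Φ.muL X Y) = ContinuousLinearMap.id ℂ _ := by
  rw [adjoint_muL]
  exact ContinuousLinearMap.ext fun z => (Φ.μ X Y).symm_apply_apply z

theorem muL_comp_ampl {X X' : C} (Y : C) (f : X ⟶ X') :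
    (Φ.muL X' Y).comp (ampl (Φ.obj Y) (Φ.map f)) = (Φ.map (f ▷ Y)).comp (Φ.muL X Y) := by
  refine ext_tmul fun x y => ?_
  have h := Φ.μ_natural f (𝟙 Y) x y
  rw [Φ.map_id, tensorHom_id] at h
  rw [ContinuousLinearMap.comp_apply, ampl_tmul]
  exact h.symm

theorem map_whiskerLeft_comp_muL {Y Y' : C} (X : C) (f : Y ⟶ Y') (x : Φ.obj X) :
    (Φ.map (X ◁ f)).comp ((Φ.muL X Y).comp (tmul (Φ.obj X) (Φ.obj Y) x)) =
      ((Φ.muL X Y').comp (tmul (Φ.obj X) (Φ.obj Y') x)).comp (Φ.map f) := by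
  refine ContinuousLinearMap.ext fun y => ?_
  have h := Φ.μ_natural (𝟙 X) f x y
  rw [Φ.map_id, id_tensorHom] at h
  exact h

/-- The coherence isomorphism `(For(L) ⊗ For(L)) ⊗ For(L) → For((L ⊗ L) ⊗ L)`. -/
def muL₃ (L : C) :
    HTensor (HTensor (Φ.obj L) (Φ.obj L)) (Φ.obj L) →L[ℂ] Φ.obj ((L ⊗ L) ⊗ L) :=
  (Φ.muL (L ⊗ L) L).comp (ampl (Φ.obj L) (Φ.muL L L))

theorem muL₃_comp_adjoint (L : C) :
    (Φ.muL₃ L).comp (adjoint (Φ.muL₃ L)) = ContinuousLinearMap.id ℂ _ := by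
  rw [muL₃, ContinuousLinearMap.adjoint_comp, adjoint_ampl, ContinuousLinearMap.comp_assoc,
    ← ContinuousLinearMap.comp_assoc (ampl _ _) (ampl _ _), ← ampl_comp, muL_comp_adjoint, ampl_id,
    ContinuousLinearMap.id_comp, muL_comp_adjoint]

theorem adjoint_comp_muL₃ (L : C) :
    (adjoint (Φ.muL₃ L)).comp (Φ.muL₃ L) = ContinuousLinearMap.id ℂ _ := by
  rw [muL₃, ContinuousLinearMap.adjoint_comp, adjoint_ampl, ContinuousLinearMap.comp_assoc,
    ← ContinuousLinearMap.comp_assoc (adjoint _) (Φ.muL (L ⊗ L) L), adjoint_comp_muL,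
    ContinuousLinearMap.id_comp, ← ampl_comp, adjoint_comp_muL, ampl_id]

/-- The associator is the evident map on the three-fold tensor product. -/
theorem map_associator_comp_muL₃ (L : C) (x : Φ.obj L) :
    (Φ.map (α_ L L L).hom).comp ((Φ.muL₃ L).comp (ampl (Φ.obj L) (tmul (Φ.obj L) (Φ.obj L) x))) =
      ((Φ.muL L (L ⊗ L)).comp (tmul (Φ.obj L) (Φ.obj (L ⊗ L)) x)).comp (Φ.muL L L) := by
  refine ext_tmul fun y z => ?_
  have h := Φ.μ_associator L L L x y z
  simp only [muL₃, ContinuousLinearMap.comp_apply, ampl_tmul]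
  exact h

variable {L : C}

/-- The operator on `For(L) ⊗ For(L)` underlying an endomorphism of `L ⊗ L`. -/
def op₂ (f : L ⊗ L ⟶ L ⊗ L) :
    HTensor (Φ.obj L) (Φ.obj L) →L[ℂ] HTensor (Φ.obj L) (Φ.obj L) :=
  conjOp (Φ.muL L L) (Φ.map f)

theorem ofHilbertTensor_op (f : L ⊗ L ⟶ L ⊗ L) : ofHilbertTensor (Φ.op f) = Φ.op₂ f := by
  rw [op₂, conjOp, adjoint_muL]
  rfl

theorem op₂_comp (f g : L ⊗ L ⟶ L ⊗ L) : Φ.op₂ (f ≫ g) = (Φ.op₂ g).comp (Φ.op₂ f) := by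
  rw [op₂, Φ.map_comp, conjOp_comp (Φ.muL_comp_adjoint L L)]
  rfl

theorem op₂_id : Φ.op₂ (𝟙 (L ⊗ L)) = ContinuousLinearMap.id ℂ _ := by
  rw [op₂, Φ.map_id, conjOp_id (Φ.adjoint_comp_muL L L)]

theorem op₂_adj (f : L ⊗ L ⟶ L ⊗ L) : Φ.op₂ (CStarCategory.adj f) = adjoint (Φ.op₂ f) := by
  rw [op₂, Φ.map_adj, op₂, adjoint_conjOp]

/-- The operator on `(For(L) ⊗ For(L)) ⊗ For(L)` underlying an endomorphism of `(L ⊗ L) ⊗ L`. -/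
def op₃ (f : (L ⊗ L) ⊗ L ⟶ (L ⊗ L) ⊗ L) :
    HTensor (HTensor (Φ.obj L) (Φ.obj L)) (Φ.obj L) →L[ℂ]
      HTensor (HTensor (Φ.obj L) (Φ.obj L)) (Φ.obj L) :=
  conjOp (Φ.muL₃ L) (Φ.map f)

theorem op₃_comp (f g : (L ⊗ L) ⊗ L ⟶ (L ⊗ L) ⊗ L) :
    Φ.op₃ (f ≫ g) = (Φ.op₃ g).comp (Φ.op₃ f) := by
  rw [op₃, Φ.map_comp, conjOp_comp (Φ.muL₃_comp_adjoint L)]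
  rfl

theorem op₃_id : Φ.op₃ (𝟙 ((L ⊗ L) ⊗ L)) = ContinuousLinearMap.id ℂ _ := by
  rw [op₃, Φ.map_id, conjOp_id (Φ.adjoint_comp_muL₃ L)]

theorem op₃_leg₁₂ (f : L ⊗ L ⟶ L ⊗ L) : Φ.op₃ (leg₁₂ f) = ampl (Φ.obj L) (Φ.op₂ f) := by
  have h : (Φ.muL₃ L).comp (ampl (Φ.obj L) (Φ.op₂ f)) = (Φ.map (leg₁₂ f)).comp (Φ.muL₃ L) := by
    rw [muL₃, ContinuousLinearMap.comp_assoc, ← ampl_comp, op₂,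
      comp_conjOp (Φ.muL_comp_adjoint L L), ampl_comp, ← ContinuousLinearMap.comp_assoc,
      muL_comp_ampl, ContinuousLinearMap.comp_assoc, leg₁₂]
  rw [op₃, conjOp, ← h, ← ContinuousLinearMap.comp_assoc, adjoint_comp_muL₃,
    ContinuousLinearMap.id_comp]

theorem op₃_leg₂₃_comp (f : L ⊗ L ⟶ L ⊗ L) (x : Φ.obj L) :
    (Φ.op₃ (leg₂₃ f)).comp (ampl (Φ.obj L) (tmul (Φ.obj L) (Φ.obj L) x)) =
      (ampl (Φ.obj L) (tmul (Φ.obj L) (Φ.obj L) x)).comp (Φ.op₂ f) := by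
  have hα : (Φ.map (α_ L L L).inv).comp (Φ.map (α_ L L L).hom) = ContinuousLinearMap.id ℂ _ := by
    rw [← Φ.map_comp, Iso.hom_inv_id, Φ.map_id]
  have h1 : (Φ.map (leg₂₃ f)).comp ((Φ.muL₃ L).comp (ampl (Φ.obj L)
      (tmul (Φ.obj L) (Φ.obj L) x))) =
      ((Φ.muL₃ L).comp (ampl (Φ.obj L) (tmul (Φ.obj L) (Φ.obj L) x))).comp (Φ.op₂ f) := by
    rw [leg₂₃, Φ.map_comp, Φ.map_comp, ContinuousLinearMap.comp_assoc,
      ContinuousLinearMap.comp_assoc, map_associator_comp_muL₃,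
      ← ContinuousLinearMap.comp_assoc (Φ.map (L ◁ f)), map_whiskerLeft_comp_muL,
      ContinuousLinearMap.comp_assoc, ← comp_conjOp (Φ.muL_comp_adjoint L L),
      ← ContinuousLinearMap.comp_assoc _ (Φ.muL L L), ← map_associator_comp_muL₃,
      ContinuousLinearMap.comp_assoc, ← ContinuousLinearMap.comp_assoc, hα,
      ContinuousLinearMap.id_comp]
    rfl
  rw [op₃, conjOp, ContinuousLinearMap.comp_assoc, ContinuousLinearMap.comp_assoc, h1,
    ContinuousLinearMap.comp_assoc, ← ContinuousLinearMap.comp_assoc (adjoint _),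
    adjoint_comp_muL₃, ContinuousLinearMap.id_comp]

/-- The unitary operator on `For(L) ⊗ For(L)` underlying a unitary endomorphism of `L ⊗ L`. -/
def opU (f : L ⊗ L ⟶ L ⊗ L) (hf : IsUnitaryMorphism f) :
    unitary (HTensor (Φ.obj L) (Φ.obj L) →L[ℂ] HTensor (Φ.obj L) (Φ.obj L)) :=
  ⟨Φ.op₂ f, Unitary.mem_iff.2 ⟨by
    change (adjoint (Φ.op₂ f)).comp (Φ.op₂ f) = ContinuousLinearMap.id ℂ _
    rw [← op₂_adj, ← op₂_comp, hf.1, op₂_id], by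
    change (Φ.op₂ f).comp (adjoint (Φ.op₂ f)) = ContinuousLinearMap.id ℂ _
    rw [← op₂_adj, ← op₂_comp, hf.2, op₂_id]⟩⟩

theorem op₃_leg₂₃_comp_op₃_leg₂₃ (f g : L ⊗ L ⟶ L ⊗ L) :
    (Φ.op₃ (leg₂₃ f)).comp (Φ.op₃ (leg₂₃ g)) = Φ.op₃ (leg₂₃ (g ≫ f)) := by
  rw [← op₃_comp, leg₂₃, leg₂₃, leg₂₃]
  simp

theorem op₃_leg₂₃_id : Φ.op₃ (leg₂₃ (𝟙 (L ⊗ L))) = ContinuousLinearMap.id ℂ _ := by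
  rw [leg₂₃]
  simp [op₃_id]

theorem adjoint_op₃_leg₂₃ (f : L ⊗ L ⟶ L ⊗ L) :
    adjoint (Φ.op₃ (leg₂₃ f)) = Φ.op₃ (leg₂₃ (CStarCategory.adj f)) := by
  let T := fun x : Φ.obj L => ampl (Φ.obj L) (tmul (Φ.obj L) (Φ.obj L) x)
  -- both sides have the same matrix coefficients with respect to the creation operators
  have h1 : ∀ x y, (adjoint (T y)).comp ((adjoint (Φ.op₃ (leg₂₃ f))).comp (T x)) =
      (adjoint (T y)).comp ((Φ.op₃ (leg₂₃ (CStarCategory.adj f))).comp (T x)) := by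
    intro x y
    rw [← ContinuousLinearMap.comp_assoc, ← ContinuousLinearMap.adjoint_comp, op₃_leg₂₃_comp,
      ContinuousLinearMap.adjoint_comp, ContinuousLinearMap.comp_assoc, op₃_leg₂₃_comp,
      ← ContinuousLinearMap.comp_assoc (adjoint (T y)), adjoint_ampl_tmul_comp_ampl_tmul, op₂_adj]
    ext
    simp
  refine ext_ampl_tmul fun x => ?_
  refine ContinuousLinearMap.adjoint.injective (ext_ampl_tmul fun y => ?_)
  have := congrArg adjoint (h1 x y)
  rwa [ContinuousLinearMap.adjoint_comp, ContinuousLinearMap.adjoint_comp (adjoint (T y)),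
    ContinuousLinearMap.adjoint_adjoint] at this

/-- The unitary operator on `(For(L) ⊗ For(L)) ⊗ For(L)` underlying the right leg of a unitary
endomorphism of `L ⊗ L`. -/
def legU (f : L ⊗ L ⟶ L ⊗ L) (hf : IsUnitaryMorphism f) :
    unitary (HTensor (HTensor (Φ.obj L) (Φ.obj L)) (Φ.obj L) →L[ℂ]
      HTensor (HTensor (Φ.obj L) (Φ.obj L)) (Φ.obj L)) :=
  ⟨Φ.op₃ (leg₂₃ f), Unitary.mem_iff.2 ⟨by
    change (adjoint (Φ.op₃ (leg₂₃ f))).comp (Φ.op₃ (leg₂₃ f)) = ContinuousLinearMap.id ℂ _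
    rw [adjoint_op₃_leg₂₃, op₃_leg₂₃_comp_op₃_leg₂₃, hf.1, op₃_leg₂₃_id], by
    change (Φ.op₃ (leg₂₃ f)).comp (adjoint (Φ.op₃ (leg₂₃ f))) = ContinuousLinearMap.id ℂ _
    rw [adjoint_op₃_leg₂₃, op₃_leg₂₃_comp_op₃_leg₂₃, hf.2, op₃_leg₂₃_id]⟩⟩

theorem isRightLeg_legU (f : L ⊗ L ⟶ L ⊗ L) (hf : IsUnitaryMorphism f) :
    IsRightLeg (Φ.opU f hf) (Φ.legU f hf) :=
  Φ.op₃_leg₂₃_comp f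

theorem coe_amplU_opU (f : L ⊗ L ⟶ L ⊗ L) (hf : IsUnitaryMorphism f) :
    (amplU _ (Φ.obj L) (Φ.opU f hf)).1 = Φ.op₃ (leg₁₂ f) :=
  (Φ.op₃_leg₁₂ f).symm

theorem coe_opU_inv (f : L ⊗ L ⟶ L ⊗ L) (hf : IsUnitaryMorphism f) :
    (Φ.opU f hf)⁻¹.1 = Φ.op₂ (CStarCategory.adj f) :=
  (Φ.op₂_adj f).symm

variable [BraidedCategory C]

theorem adj_braiding (hc : IsUnitaryBraiding C) (X Y : C) :
    CStarCategory.adj (β_ X Y).hom = (β_ X Y).inv := by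
  rw [← Category.comp_id (CStarCategory.adj (β_ X Y).hom), ← (β_ X Y).hom_inv_id,
    ← Category.assoc, (hc X Y).2, Category.id_comp]

/-- The operators underlying a regular multiplicative unitary in a braided category. -/
theorem isBraidedMU (hc : IsBiregularBraiding Φ) {F : L ⊗ L ⟶ L ⊗ L}
    (hF : IsMultiplicativeUnitary F) (hreg : IsBiregular Φ F) :
    IsBraidedMU (Φ.opU (β_ L L).hom (hc.unitary L L)) (Φ.opU F hF.unitary)
      (Φ.legU (β_ L L).hom (hc.unitary L L)) (Φ.legU F hF.unitary) where
  leg_braiding := Φ.isRightLeg_legU _ _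
  leg := Φ.isRightLeg_legU _ _
  naturality := by
    refine Subtype.ext ?_
    change ((Φ.op₃ _).comp (amplU _ _ _).1).comp (Φ.op₃ _) =
      ((amplU _ _ _).1.comp (Φ.op₃ _)).comp (amplU _ _ _).1
    rw [coe_amplU_opU, coe_amplU_opU]
    simp only [← op₃_comp]
    rw [leg₂₃_braiding_naturality]
  pentagon := by
    have hinv : (amplU _ (Φ.obj L) (Φ.opU (β_ L L).hom (hc.unitary L L)))⁻¹.1 =
        Φ.op₃ (leg₁₂ (β_ L L).inv) := by
      refine (eq_inv_of_comp_eq_id ?_).symm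
      rw [coe_amplU_opU, ← op₃_comp, leg₁₂, leg₁₂, hom_inv_whiskerRight, op₃_id]
    refine Subtype.ext ?_
    change (Φ.op₃ _).comp (amplU _ _ _).1 =
      ((((amplU _ _ _).1.comp ((amplU _ _ _)⁻¹).1).comp (Φ.op₃ _)).comp (amplU _ _ _).1).comp
        (Φ.op₃ _)
    rw [hinv, coe_amplU_opU, coe_amplU_opU]
    simp only [← op₃_comp]
    rw [hF.pentagon]
  regular_braiding := by
    rw [← hc.regular_op L L, leftSlices_eq, ofHilbertTensor_op]
    rfl
  regular := by
    have h : slices (Φ.opU (β_ L L).hom (hc.unitary L L) * (Φ.opU F hF.unitary)⁻¹) =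
        compacts (Φ.obj L) (Φ.obj L) := by
      rw [← hreg.regular_op, leftSlices_eq, ofHilbertTensor_op, op₂_comp, op₂_adj]
      rfl
    rw [← adjS_compacts, ← h, adjS_slices]
    congr 1
    group
  braid := by
    refine Subtype.ext ?_
    change ((amplU _ _ _).1.comp (Φ.op₃ _)).comp (amplU _ _ _).1 =
      ((Φ.op₃ _).comp (amplU _ _ _).1).comp (Φ.op₃ _)
    rw [coe_amplU_opU]
    simp only [← op₃_comp]
    rw [leg₁₂_braiding_naturality]
  naturality_left := by
    refine Subtype.ext ?_
    change ((amplU _ _ _).1.comp (Φ.op₃ _)).comp (amplU _ _ _).1 =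
      ((Φ.op₃ _).comp (amplU _ _ _).1).comp (Φ.op₃ _)
    rw [coe_amplU_opU, coe_amplU_opU]
    simp only [← op₃_comp]
    rw [leg₁₂_braiding_naturality]

end FibreFunctor

end Realisation

/-! ### The multiplier theorem -/

section Conclusion

theorem IsRegularMU.actsNondegenerately_twisted {H : Type*} [NormedAddCommGroup H]
    [InnerProductSpace ℂ H] [CompleteSpace H]
    (d X : unitary (HTensor H H →L[ℂ] HTensor H H)) :
    ActsNondegenerately (IsRegularMU.twisted d X) :=
  (actsNondegenerately_uline _).cmul
    ((actsNondegenerately_slices X).amplS.cmul (actsNondegenerately_uline d))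

/-- A closed space of operators with `[D D] = D`, `D* = D` and `[F D] = D = [D F]` is a
`C*`-algebra with `F` as a multiplier. -/
theorem isMultiplierOf_of_cmul {E : Type*} [NormedAddCommGroup E] [InnerProductSpace ℂ E]
    [CompleteSpace E] {D : Submodule ℂ (E →L[ℂ] E)} {F : unitary (E →L[ℂ] E)}
    (hD : IsClosed (D : Set (E →L[ℂ] E))) (hn : ActsNondegenerately D) (hmul : D ⋆ D = D)
    (hadj : adjS D = D) (hl : uline F ⋆ D = D) (hr : D ⋆ uline F = D) :
    IsMultiplierOf D F.1 := by
  have hF : F.1 ∈ uline F := by rw [uline, line]; exact subset_closedSpan _ rfl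
  refine ⟨⟨hD, fun a ha b hb => ?_, fun a ha => ?_⟩, hn, fun a ha => ?_, fun a ha => ?_⟩
  · exact hmul.le (comp_mem_cmul ha hb)
  · exact hadj.le (adjoint_mem_adjS ha)
  · exact hl.le (comp_mem_cmul hF ha)
  · exact hr.le (comp_mem_cmul ha hF)

variable {C : Type u} [Category.{v} C] [MonoidalCategory C] [WStarCategory C]

namespace FibreFunctor

variable (Φ : FibreFunctor.{u, v, w} C) {L : C}

theorem leftSliceAlgebra_eq (F : L ⊗ L ⟶ L ⊗ L) (hF : IsUnitaryMorphism F) :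
    leftSliceAlgebra Φ F = slices (Φ.opU F hF) := by
  rw [leftSliceAlgebra, leftSlices_eq, ofHilbertTensor_op]
  rfl

variable [BraidedCategory C]

theorem coe_opU_braiding_inv (hc : IsUnitaryBraiding C) :
    (Φ.opU (β_ L L).hom (hc L L))⁻¹.1 = Φ.op₂ (β_ L L).inv := by
  rw [coe_opU_inv, adj_braiding hc]

theorem leftSliceAlgebra_dualUnitary_eq (hc : IsUnitaryBraiding C) (F : L ⊗ L ⟶ L ⊗ L)
    (hF : IsUnitaryMorphism F) :
    leftSliceAlgebra Φ (dualUnitary F) = slices (Φ.opU (β_ L L).hom (hc L L) *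
      (Φ.opU F hF)⁻¹ * (Φ.opU (β_ L L).hom (hc L L))⁻¹) := by
  have h : Φ.op₂ (dualUnitary F) = (Φ.opU (β_ L L).hom (hc L L) *
      (Φ.opU F hF)⁻¹ * (Φ.opU (β_ L L).hom (hc L L))⁻¹).1 := by
    change _ = ((Φ.op₂ _).comp ((Φ.opU F hF)⁻¹).1).comp ((Φ.opU _ _)⁻¹).1
    rw [coe_opU_inv, coe_opU_braiding_inv, dualUnitary, op₂_comp, op₂_comp]
  rw [leftSliceAlgebra, leftSlices_eq, ofHilbertTensor_op, h]
  rfl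

theorem ofHilbertTensor_inclRight (b : Φ.obj L →L[ℂ] Φ.obj L) :
    ofHilbertTensor (inclRight Φ L L b) =
      (Φ.op₂ (β_ L L).inv).comp ((ampl (Φ.obj L) b).comp (Φ.op₂ (β_ L L).hom)) := by
  rw [← ofHilbertTensor_op, ← ofHilbertTensor_op]
  rfl

theorem rightFactor_eq_closedSpan (hc : IsUnitaryBraiding C) (F : L ⊗ L ⟶ L ⊗ L)
    (hF : IsUnitaryMorphism F) :
    rightFactor (Φ.opU (β_ L L).hom (hc L L)) (Φ.opU F hF) =
      closedSpan {T | ∃ b ∈ leftSliceAlgebra Φ F, T = ofHilbertTensor (inclRight Φ L L b)} := by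
  rw [rightFactor, IsRegularMU.twisted, uline, uline, amplS, closedSpan_cmul_line,
    closedSpan_line_cmul, coe_opU_braiding_inv, ← Φ.leftSliceAlgebra_eq]
  congr 1
  ext T
  constructor
  · rintro ⟨_, ⟨_, ⟨b, hb, rfl⟩, rfl⟩, rfl⟩
    exact ⟨b, hb, (Φ.ofHilbertTensor_inclRight b).symm⟩
  · rintro ⟨b, hb, rfl⟩
    exact ⟨_, ⟨_, ⟨b, hb, rfl⟩, rfl⟩, Φ.ofHilbertTensor_inclRight b⟩

theorem leftFactor_eq_closedSpan (hc : IsUnitaryBraiding C) (F : L ⊗ L ⟶ L ⊗ L)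
    (hF : IsUnitaryMorphism F) :
    leftFactor (Φ.opU (β_ L L).hom (hc L L)) (Φ.opU F hF) =
      closedSpan {T | ∃ a ∈ leftSliceAlgebra Φ (dualUnitary F),
        T = ofHilbertTensor (inclLeft Φ L L a)} := by
  rw [leftFactor, amplS, ← Φ.leftSliceAlgebra_dualUnitary_eq]
  congr 1
  ext T
  exact ⟨fun ⟨a, ha, h⟩ => ⟨a, ha, h.symm⟩, fun ⟨a, ha, h⟩ => ⟨a, ha, h.symm⟩⟩

theorem braidedTensor_eq (hc : IsUnitaryBraiding C) (F : L ⊗ L ⟶ L ⊗ L)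
    (hF : IsUnitaryMorphism F) :
    braidedTensor Φ (leftSliceAlgebra Φ (dualUnitary F)) (leftSliceAlgebra Φ F) =
      braidedProduct (Φ.opU (β_ L L).hom (hc L L)) (Φ.opU F hF) := by
  rw [braidedProduct, rightFactor_eq_closedSpan, leftFactor_eq_closedSpan,
    closedSpan_cmul_closedSpan]
  change closedSpan (E := HTensor _ _) (F := HTensor _ _) _ = _
  congr 1
  ext T
  constructor
  · rintro ⟨a, ha, b, hb, rfl⟩
    exact ⟨_, ⟨a, ha, rfl⟩, _, ⟨b, hb, rfl⟩, rfl⟩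
  · rintro ⟨_, ⟨a, ha, rfl⟩, _, ⟨b, hb, rfl⟩, rfl⟩
    exact ⟨a, ha, b, hb, rfl⟩

theorem closedSpan_mul_op_mul_eq (hc : IsUnitaryBraiding C) (F : L ⊗ L ⟶ L ⊗ L)
    (hF : IsUnitaryMorphism F) :
    closedSpan {T | ∃ a ∈ leftSliceAlgebra Φ (dualUnitary F), ∃ b ∈ leftSliceAlgebra Φ F,
        T = inclLeft Φ L L a * Φ.op F * inclRight Φ L L b} =
      leftFactor (Φ.opU (β_ L L).hom (hc L L)) (Φ.opU F hF) ⋆ uline (Φ.opU F hF) ⋆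
        rightFactor (Φ.opU (β_ L L).hom (hc L L)) (Φ.opU F hF) := by
  have hop : (Φ.opU F hF).1 = ofHilbertTensor (Φ.op F) := (Φ.ofHilbertTensor_op F).symm
  rw [rightFactor_eq_closedSpan, leftFactor_eq_closedSpan, uline, closedSpan_line_cmul,
    closedSpan_cmul_closedSpan, hop]
  change closedSpan (E := HTensor _ _) (F := HTensor _ _) _ = _
  congr 1
  ext T
  constructor
  · rintro ⟨a, ha, b, hb, rfl⟩
    exact ⟨_, ⟨a, ha, rfl⟩, _, ⟨_, ⟨b, hb, rfl⟩, rfl⟩, rfl⟩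
  · rintro ⟨_, ⟨a, ha, rfl⟩, _, ⟨_, ⟨b, hb, rfl⟩, rfl⟩, rfl⟩
    exact ⟨a, ha, b, hb, rfl⟩

end FibreFunctor

end Conclusion

end

theorem mainTheorem10 {C : Type u} [Category.{v} C] [MonoidalCategory C] [BraidedCategory C]
    [WStarCategory C] [MonoidalWStarCategory C] (Φ : FibreFunctor.{u, v, w} C)
    (hc : IsBiregularBraiding Φ) {L : C} (F : L ⊗ L ⟶ L ⊗ L)
    (hF : IsMultiplicativeUnitary F) (hreg : IsBiregular Φ F) :
    IsMultiplierOf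
        (braidedTensor Φ (leftSliceAlgebra Φ (dualUnitary F)) (leftSliceAlgebra Φ F)) (Φ.op F) ∧
      closedSpan {T | ∃ a ∈ leftSliceAlgebra Φ (dualUnitary F), ∃ b ∈ leftSliceAlgebra Φ F,
          T = inclLeft Φ L L a * Φ.op F * inclRight Φ L L b} =
        braidedTensor Φ (leftSliceAlgebra Φ (dualUnitary F)) (leftSliceAlgebra Φ F) := by
  have h := Φ.isBraidedMU hc hF hreg
  have hD := Φ.braidedTensor_eq hc.unitary F hF.unitary
  have hop : (Φ.opU F hF.unitary).1 = HTensor.ofHilbertTensor (Φ.op F) := (Φ.ofHilbertTensor_op F).symm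
  constructor
  · have hM := isMultiplierOf_of_cmul (isClosed_cmul _ _)
      ((actsNondegenerately_slices _).amplS.cmul (IsRegularMU.actsNondegenerately_twisted _ _))
      h.braidedProduct_cmul_self h.adjS_braidedProduct h.uline_cmul_braidedProduct
      h.braidedProduct_cmul_uline
    rw [hop] at hM
    exact Eq.mpr (congrArg (IsMultiplierOf · (Φ.op F)) hD) hM
  · rw [Φ.closedSpan_mul_op_mul_eq hc.unitary F hF.unitary,
      h.leftFactor_cmul_uline_cmul_rightFactor]
    exact hD.symm
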